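/- Let $0<\alpha<1$, $\rho>0$, $\mu>0$ and $0<\tau\le 1$. Let $f_G(y,t)=\frac{\mu^{\rho t}}{\Gamma(\rho t)}\,y^{\rho t-1}e^{-\mu y}$ ($y,t>0$) be the density of the gamma subordinator, let $g_\alpha(x,y)=\frac1{2\pi}\int_{\mathbb R}e^{-i\theta x}\,e^{-y(-i\theta)^\alpha}\,d\theta$ (principal branch; $x,y>0$) be the density at time $y$ of the $\alpha$-stable subordinator with Laplace transform $e^{-yu^\alpha}$, and let $$f_{M_{\alpha,\rho,\mu}(t)}(x)=\sum_{k=0}^\infty(-1)^k\,\frac{\mu^{\rho t+k}\,\Gamma(\rho t+k)}{\Gamma(\rho t)\,\Gamma(k+1)}\;\frac{x^{\alpha(\rho t+k)-1}}{\Gamma(\alpha(\rho t+k))},\qquad x,t>0,$$ be the density of the Mittag-Leffler Lévy process, whose Laplace transform is $\left(\mu/(\mu+u^\alpha)\right)^{\rho t}$. Let $\psi=\Gamma'/\Gamma$ be the digamma function. For $\nu>0$ put $\frac{\partial^{-\nu}}{\partial t^{-\nu}}h(t)=\frac1{\Gamma(\nu)}\int_0^t(t-u)^{\nu-1}h(u)\,du$,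 let $\frac{\partial^{0}}{\partial t^{0}}h=h$, and for $0<\tau\le1$ let $\frac{\partial^{\tau}}{\partial t^{\tau}}h=\frac{d}{dt}\,\frac{\partial^{\tau-1}}{\partial t^{\tau-1}}h$ (Riemann–Liouville operators with base point $0$). Then for all $x>0$ and $t>0$ $$\frac{\partial^\tau}{\partial t^\tau}f_{M_{\alpha,\rho,\mu}(t)}(x)=\rho\,\frac{\partial^{\tau-1}}{\partial t^{\tau-1}}\left[\bigl(\log\mu-\psi(\rho t)\bigr)f_{M_{\alpha,\rho,\mu}(t)}(x)+\int_0^\infty g_\alpha(x,y)\,(\log y)\,f_G(y,t)\,dy\right],$$ where all the integrals converge absolutely and the derivative on the left-hand side exists. -/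

import Mathlib

open MeasureTheory ProbabilityTheory Set

noncomputable section

namespace FracML

/-- Riemann-Liouville integral of order `ν ≥ 0` with base point `0`, the identity for `ν = 0`:
`(I^ν f)(t) = Γ(ν)⁻¹ ∫₀ᵗ (t - u)^(ν - 1) f(u) du`. -/
def rlIntegral (ν : ℝ) (f : ℝ → ℝ) (t : ℝ) : ℝ :=
  if ν = 0 then f t else (Real.Gamma ν)⁻¹ * ∫ u in (0 : ℝ)..t, (t - u) ^ (ν - 1) * f u

/-- The integral in `rlIntegral ν f t` converges absolutely (no condition for `ν = 0`). -/
def RLIntegrable (ν : ℝ) (f : ℝ → ℝ) (t : ℝ) : Prop :=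
  ν = 0 ∨ IntervalIntegrable (fun u => (t - u) ^ (ν - 1) * f u) volume 0 t

/-- Riemann-Liouville operator `∂^σ/∂t^σ` of real order `σ` with base point `0`:
`(d/dt)^n I^(n - σ)` with `n = ⌈σ⌉` for `σ > 0`, and the integral `I^(-σ)` for `σ ≤ 0`
(where `⌈σ⌉₊ = 0`). -/
def rlDeriv (σ : ℝ) (f : ℝ → ℝ) (t : ℝ) : ℝ :=
  iteratedDeriv ⌈σ⌉₊ (rlIntegral ((⌈σ⌉₊ : ℝ) - σ) f) t

/-- The digamma function on the reals. -/
def digamma (s : ℝ) : ℝ := (Complex.digamma (s : ℂ)).re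

/-- Density at `x` of the `α`-stable subordinator at time `y > 0` (Laplace transform
`exp (-y u^α)`), as the Fourier inverse of its characteristic function
`θ ↦ exp (-y (-iθ)^α)`, with the principal branch of the power. -/
def stableDensity (α x y : ℝ) : ℝ :=
  (2 * Real.pi)⁻¹ *
    (∫ θ : ℝ, Complex.exp (-(Complex.I * θ * x)) *
      Complex.exp (-((y : ℂ) * (-(Complex.I * θ)) ^ (α : ℂ)))).re

/-- Density at `x > 0` of the gamma subordinator at time `t > 0`:
`μ^(ρ t) / Γ(ρ t) * x^(ρ t - 1) * exp (-μ x)`. -/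
def gammaDensity (ρ μ x t : ℝ) : ℝ := gammaPDFReal (ρ * t) μ x

/-- Density at `x > 0` of the Mittag-Leffler Lévy process at time `t > 0`. -/
def mlDensity (α ρ μ x t : ℝ) : ℝ :=
  ∑' k : ℕ, (-1) ^ k *
    (μ ^ (ρ * t + k) * Real.Gamma (ρ * t + k) / (Real.Gamma (ρ * t) * Real.Gamma (k + 1))) *
    (x ^ (α * (ρ * t + k) - 1) / Real.Gamma (α * (ρ * t + k)))

/-- The function of `t` inside the operator on the right-hand side of the equation. -/
def mlBracket (α ρ μ x t : ℝ) : ℝ :=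
  (Real.log μ - digamma (ρ * t)) * mlDensity α ρ μ x t +
    ∫ y in Ioi (0 : ℝ), stableDensity α x y * Real.log y * gammaDensity ρ μ y t

end FracML

end

/-!
Two integrations by parts on a vertical line in Bromwich's formula for the stable density give
`x² g_α(x, y)` as the inverse Laplace transform of `∂²/∂u² exp (-y u^α)`. Letting the line recede
to the right bounds `g_α(x, y)` by a multiple of `y exp (-k y)` for every `k`, and the Mellin
transform in `y` is `Γ(s) x^(α s - 1) / Γ(α s)`. Expanding `exp (-μ y)` in the mixture
`∫ g_α(x, y) f_G(y, t) dy` under the integral therefore produces the Mittag-Leffler series.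

The mixture is a Mellin transform evaluated at the shape `s = ρ t`, divided by `Γ(s)`. It is
holomorphic in `s` for `Re s > -1`, vanishes at `s = 0` because `1 / Γ(0) = 0`, and its logarithmic
derivative in `s` brings out `log μ - ψ(s)` and the factor `log y`. So the density is a `C¹`
function of `t ≥ 0` vanishing at `0`, and for such functions Riemann-Liouville integration
commutes with `d/dt`.
-/

namespace FracML

open Complex (I)
open Filter Topology

section HalfPlane

variable {α : ℝ} {u : ℂ}

lemma re_cpow_ofReal (hu : u ≠ 0) (a : ℝ) :
    (u ^ (a : ℂ)).re = ‖u‖ ^ a * Real.cos (a * u.arg) := by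
  rw [Complex.cpow_def_of_ne_zero hu, Complex.exp_re, Complex.re_mul_ofReal,
    Complex.im_mul_ofReal, Complex.log_re, Complex.log_im,
    Real.rpow_def_of_pos (norm_pos_iff.2 hu), mul_comm u.arg]

lemma cos_mul_pi_div_two_pos (hα : |α| < 1) : 0 < Real.cos (α * (Real.pi / 2)) := by
  rw [abs_lt] at hα
  apply Real.cos_pos_of_mem_Ioo
  constructor <;> nlinarith [Real.pi_pos]

lemma norm_rpow_mul_cos_le_re_cpow (hα0 : 0 < α) (hα2 : α ≤ 2) (hu : 0 ≤ u.re) :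
    ‖u‖ ^ α * Real.cos (α * (Real.pi / 2)) ≤ (u ^ (α : ℂ)).re := by
  rcases eq_or_ne u 0 with rfl | h0
  · simp [hα0.ne']
  have harg := Complex.abs_arg_le_pi_div_two_iff.2 hu
  rw [re_cpow_ofReal h0, ← Real.cos_abs (α * u.arg), abs_mul, abs_of_pos hα0]
  gcongr
  apply Real.cos_le_cos_of_nonneg_of_le_pi (by positivity)
  · nlinarith [Real.pi_pos]
  · gcongr

lemma re_cpow_pos (hα : |α| < 1) (hu : 0 < u.re) : 0 < (u ^ (α : ℂ)).re := by
  have h0 : u ≠ 0 := fun h => by simp [h] at hu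
  have harg := abs_lt.1 (Complex.abs_arg_lt_pi_div_two_iff.2 (Or.inl hu))
  rw [re_cpow_ofReal h0]
  refine mul_pos (by positivity) (Real.cos_pos_of_mem_Ioo (abs_lt.1 ?_))
  rw [abs_mul]
  nlinarith [abs_nonneg α, abs_lt.2 harg, abs_nonneg u.arg, Real.pi_pos]

lemma continuousOn_cpow_const {a : ℂ} (ha : 0 < a.re) :
    ContinuousOn (fun z : ℂ => z ^ a) {z | 0 ≤ z.re} := fun _ hz =>
  (Complex.continuousAt_cpow_const_of_re_pos (Or.inl hz) ha).continuousWithinAt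

end HalfPlane

section Bromwich

open scoped ComplexConjugate

variable {E : Type*} [NormedAddCommGroup E] [NormedSpace ℂ E]

lemma tendsto_integral_horizontal_segment {f : ℂ → E} {a b : ℝ} {m : ℝ → ℝ}
    (hab : a ≤ b) (hm : Tendsto m atTop (𝓝 0))
    (hf : ∀ u : ℂ, u.re ∈ Icc a b → ‖f u‖ ≤ m |u.im|) :
    Tendsto (fun T : ℝ => ∫ s in a..b, f (s + T * I)) (cocompact ℝ) (𝓝 0) := by
  have hlim : Tendsto (fun T : ℝ => m |T| * |b - a|) (cocompact ℝ) (𝓝 0) := by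
    simpa using (hm.comp (tendsto_norm_cocompact_atTop (E := ℝ))).mul_const |b - a|
  refine squeeze_zero_norm (fun T => ?_) hlim
  refine intervalIntegral.norm_integral_le_of_norm_le_const fun s hs => ?_
  rw [uIoc_of_le hab] at hs
  simpa using hf (s + T * I) (by simpa using Ioc_subset_Icc_self hs)

lemma integral_vertical_line_eq [CompleteSpace E] {f : ℂ → E} {a b : ℝ} {m : ℝ → ℝ} (hab : a ≤ b)
    (hcont : ContinuousOn f (Complex.re ⁻¹' Icc a b))
    (hdiff : DifferentiableOn ℂ f (Complex.re ⁻¹' Ioo a b)) (hm : Tendsto m atTop (𝓝 0))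
    (hf : ∀ u : ℂ, u.re ∈ Icc a b → ‖f u‖ ≤ m |u.im|)
    (ha : Complex.VerticalIntegrable f a) (hb : Complex.VerticalIntegrable f b) :
    ∫ v : ℝ, f (a + v * I) = ∫ v : ℝ, f (b + v * I) := by
  have hrect (T : ℝ) : (((∫ s in a..b, f (s + (-T : ℝ) * I)) - ∫ s in a..b, f (s + T * I)) +
      I • ∫ v in (-T)..T, f (b + v * I)) - I • ∫ v in (-T)..T, f (a + v * I) = 0 := by
    have h := Complex.integral_boundary_rect_eq_zero_of_continuousOn_of_differentiableOn f
      (a + (-T : ℝ) * I) (b + T * I)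
      (hcont.mono fun u hu => by simpa [uIcc_of_le hab] using hu.1)
      (hdiff.mono fun u hu => by simpa [hab] using hu.1)
    simpa using h
  have hside := tendsto_integral_horizontal_segment hab hm hf
  have hline (c : ℝ) (hc : Integrable fun v : ℝ => f (c + v * I)) :
      Tendsto (fun T : ℝ => I • ∫ v in (-T)..T, f (c + v * I)) atTop
        (𝓝 (I • ∫ v : ℝ, f (c + v * I))) := by
    have h := intervalIntegral_tendsto_integral hc tendsto_neg_atTop_atBot tendsto_id
    exact h.const_smul I
  have hlim := (((hside.comp (tendsto_neg_atTop_atBot.mono_right atBot_le_cocompact)).sub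
    (hside.mono_left atTop_le_cocompact)).add (hline b hb)).sub (hline a ha)
  have h0 := tendsto_nhds_unique hlim
    (tendsto_const_nhds.congr fun T => (hrect T).symm)
  rw [sub_zero, zero_add, ← smul_sub, smul_eq_zero_iff_right Complex.I_ne_zero, sub_eq_zero] at h0
  exact h0.symm

/-- The inverse Laplace transform of `F` at `x`, taken along the vertical line `Re u = c`. -/
noncomputable def bromwich (c : ℝ) (F : ℂ → ℂ) (x : ℝ) : ℂ :=
  (2 * Real.pi : ℂ)⁻¹ * ∫ v : ℝ, Complex.exp ((c + v * I) * x) * F (c + v * I)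

lemma norm_exp_vertical_mul (c v x : ℝ) :
    ‖Complex.exp ((c + v * I) * x)‖ = Real.exp (c * x) := by
  rw [Complex.norm_exp, Complex.re_mul_ofReal]
  simp

lemma continuous_exp_vertical_mul (c x : ℝ) :
    Continuous fun v : ℝ => Complex.exp ((c + v * I) * x) := by
  fun_prop

lemma verticalIntegrable_exp_mul {F : ℂ → ℂ} {c : ℝ} (hF : Complex.VerticalIntegrable F c) (x : ℝ) :
    Complex.VerticalIntegrable (fun u => Complex.exp (u * x) * F u) c :=
  hF.bdd_mul (continuous_exp_vertical_mul c x).aestronglyMeasurable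
    (ae_of_all _ fun v => (norm_exp_vertical_mul c v x).le)

lemma hasDerivAt_vertical (c v : ℝ) : HasDerivAt (fun v : ℝ => (c + v * I : ℂ)) I v := by
  simpa using ((Complex.ofRealCLM.hasDerivAt (x := v)).mul_const I).const_add (c : ℂ)

lemma mul_bromwich_of_hasDerivAt {c : ℝ} {F F' : ℂ → ℂ}
    (hF : ∀ u : ℂ, u.re = c → HasDerivAt F (F' u) u)
    (hi : Complex.VerticalIntegrable F c) (hi' : Complex.VerticalIntegrable F' c) (x : ℝ) :
    x * bromwich c F x = -bromwich c F' x := by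
  have hexp (v : ℝ) : HasDerivAt (fun v : ℝ => Complex.exp ((c + v * I) * x))
      (Complex.exp ((c + v * I) * x) * (I * x)) v :=
    ((hasDerivAt_vertical c v).mul_const (x : ℂ)).cexp
  have hF' (v : ℝ) : HasDerivAt (fun v : ℝ => F (c + v * I)) (F' (c + v * I) * I) v :=
    (hF _ (by simp)).comp v (hasDerivAt_vertical c v)
  have hparts := integral_mul_deriv_eq_deriv_mul_of_integrable (fun v _ => hexp v)
    (fun v _ => hF' v)
    (((verticalIntegrable_exp_mul hi' x).mul_const I).congr
      (ae_of_all _ fun v => by simp only [Pi.mul_apply, mul_assoc]))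
    (((verticalIntegrable_exp_mul hi x).mul_const (I * x)).congr
      (ae_of_all _ fun v => by simp only [Pi.mul_apply]; ring))
    (verticalIntegrable_exp_mul hi x)
  have hleft : ∫ v : ℝ, Complex.exp ((c + v * I) * x) * (F' (c + v * I) * I) =
      I * ∫ v : ℝ, Complex.exp ((c + v * I) * x) * F' (c + v * I) := by
    rw [← integral_const_mul]; congr with v; ring
  have hright : ∫ v : ℝ, Complex.exp ((c + v * I) * x) * (I * x) * F (c + v * I) =
      I * (x * ∫ v : ℝ, Complex.exp ((c + v * I) * x) * F (c + v * I)) := by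
    rw [← integral_const_mul, ← integral_const_mul]; congr with v; ring
  rw [hleft, hright, ← mul_neg] at hparts
  rw [bromwich, bromwich, mul_left_comm, ← mul_neg, mul_left_cancel₀ Complex.I_ne_zero hparts,
    neg_neg]

lemma bromwich_laplace_eq {f : ℝ → ℂ} {c x : ℝ}
    (hf : Integrable fun y : ℝ => Complex.exp (-(c * y)) * f y)
    (hLf : Complex.VerticalIntegrable (fun u => ∫ y : ℝ, Complex.exp (-(u * y)) * f y) c)
    (hx : ContinuousAt f x) :
    bromwich c (fun u => ∫ y : ℝ, Complex.exp (-(u * y)) * f y) x = f x := by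
  set L : ℝ → ℂ := fun v => ∫ y : ℝ, Complex.exp (-((c + v * I) * y)) * f y
  have hfourier : FourierTransform.fourier (fun y : ℝ => Complex.exp (-(c * y)) * f y) =
      fun w => L (2 * Real.pi * w) := by
    ext w
    rw [Real.fourier_eq']
    congr with y
    rw [smul_eq_mul, ← mul_assoc, ← Complex.exp_add]
    congr 2
    simp
    ring
  have hinv := hf.fourierInv_fourier_eq
    (by rw [hfourier]; exact hLf.comp_mul_left' (by positivity : 2 * Real.pi ≠ 0))
    (v := x) (by fun_prop)
  rw [hfourier, Real.fourierInv_eq'] at hinv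
  have hscale := Measure.integral_comp_mul_left
    (fun v : ℝ => Complex.exp (v * x * I) * L v) (2 * Real.pi)
  calc bromwich c (fun u => ∫ y : ℝ, Complex.exp (-(u * y)) * f y) x
      = Complex.exp (c * x) *
          ((2 * Real.pi : ℂ)⁻¹ * ∫ v : ℝ, Complex.exp (v * x * I) * L v) := by
        rw [bromwich, mul_left_comm, ← integral_const_mul (Complex.exp (c * x))]
        congr 2 with v
        rw [← mul_assoc, ← Complex.exp_add]
        congr 2
        ring
    _ = Complex.exp (c * x) * (Complex.exp (-(c * x)) * f x) := by
        rw [← hinv]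
        have h2π : |(2 * Real.pi)⁻¹| = (2 * Real.pi)⁻¹ := abs_of_pos (by positivity)
        rw [h2π, Complex.real_smul] at hscale
        push_cast at hscale
        rw [← hscale]
        congr with w
        rw [smul_eq_mul]
        congr 2
        simp
        ring
    _ = f x := by rw [← mul_assoc, ← Complex.exp_add, add_neg_cancel, Complex.exp_zero, one_mul]

lemma conj_bromwich {c : ℝ} {F : ℂ → ℂ} (hF : ∀ u : ℂ, u.re = c → F (conj u) = conj (F u))
    (x : ℝ) : conj (bromwich c F x) = bromwich c F x := by
  rw [bromwich, map_mul, ← integral_conj, ← integral_neg_eq_self]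
  congr 1
  · simp [map_ofNat]
  · congr with v
    have hconj : conj (c + (-v : ℝ) * I : ℂ) = c + v * I := by simp
    rw [map_mul, ← Complex.exp_conj, map_mul, ← hF _ (by simp), hconj, Complex.conj_ofReal]

lemma bromwich_const_mul (c : ℝ) (a : ℂ) (F : ℂ → ℂ) (x : ℝ) :
    bromwich c (fun u => a * F u) x = a * bromwich c F x := by
  simp only [bromwich, mul_left_comm _ a, integral_const_mul]

lemma bromwich_congr {c : ℝ} {F G : ℂ → ℂ} (h : ∀ u : ℂ, u.re = c → F u = G u) (x : ℝ) :
    bromwich c F x = bromwich c G x := by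
  rw [bromwich, bromwich]
  congr with v
  rw [h _ (by simp)]

lemma norm_bromwich_le {c : ℝ} {F : ℂ → ℂ} {B : ℝ → ℝ} (hB : Integrable B)
    (h : ∀ v : ℝ, ‖F (c + v * I)‖ ≤ B v) (x : ℝ) :
    ‖bromwich c F x‖ ≤ (2 * Real.pi)⁻¹ * (Real.exp (c * x) * ∫ v, B v) := by
  have hpi : ‖(2 * Real.pi : ℂ)⁻¹‖ = (2 * Real.pi)⁻¹ := by
    simp [abs_of_pos Real.pi_pos]
  rw [bromwich, norm_mul, hpi, ← integral_const_mul]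
  gcongr
  refine norm_integral_le_of_norm_le (hB.const_mul _) (ae_of_all _ fun v => ?_)
  rw [norm_mul, norm_exp_vertical_mul]
  gcongr
  exact h v

lemma hasMellin_bromwich {c : ℝ} {F : ℝ → ℂ → ℂ} {s : ℂ}
    (hF : Integrable (fun p : ℝ × ℝ => (p.1 : ℂ) ^ (s - 1) * F p.1 (c + p.2 * I))
      ((volume.restrict (Ioi 0)).prod volume)) (x : ℝ) :
    HasMellin (fun y => bromwich c (F y) x) s
      (bromwich c (fun u => mellin (fun y => F y u) s) x) := by
  have hexp : Integrable (Function.uncurry fun y v : ℝ => Complex.exp ((c + v * I) * x) *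
      ((y : ℂ) ^ (s - 1) * F y (c + v * I))) ((volume.restrict (Ioi (0 : ℝ))).prod volume) :=
    hF.bdd_mul (by fun_prop) (ae_of_all _ fun p => (norm_exp_vertical_mul c p.2 x).le)
  have hpull (y : ℝ) : (y : ℂ) ^ (s - 1) • bromwich c (F y) x = (2 * Real.pi : ℂ)⁻¹ *
      ∫ v : ℝ, Complex.exp ((c + v * I) * x) * ((y : ℂ) ^ (s - 1) * F y (c + v * I)) := by
    simp only [bromwich, smul_eq_mul, mul_left_comm _ ((y : ℂ) ^ (s - 1)), integral_const_mul]
  constructor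
  · simp only [MellinConvergent, hpull]
    exact hexp.integral_prod_left.const_mul _
  · simp only [mellin, hpull]
    rw [integral_const_mul, integral_integral_swap hexp, bromwich]
    simp only [integral_const_mul, smul_eq_mul]

lemma le_norm_vertical (c v : ℝ) : c ≤ ‖(c + v * I : ℂ)‖ := by
  simpa using Complex.re_le_norm (c + v * I : ℂ)

lemma integrable_norm_vertical_rpow {a c : ℝ} (ha : a < -1) (hc : 0 < c) :
    Integrable fun v : ℝ => ‖(c + v * I : ℂ)‖ ^ a := by
  have h := ((integrable_rpow_neg_one_add_norm_sq (E := ℝ) (μ := volume) (r := -a)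
    (by simp; linarith)).comp_div hc.ne').const_mul (c ^ a)
  refine h.congr (ae_of_all _ fun v => ?_)
  have hnorm : ‖(c + v * I : ℂ)‖ ^ 2 = c ^ 2 * (1 + ‖v / c‖ ^ 2) := by
    rw [← Complex.normSq_eq_norm_sq, Complex.normSq_add_mul_I, Real.norm_eq_abs, sq_abs]
    field_simp
  have hsq {b : ℝ} (hb : 0 ≤ b) : (b ^ 2) ^ (a / 2) = b ^ a := by
    rw [← Real.rpow_natCast, ← Real.rpow_mul hb]
    congr 1
    push_cast
    ring
  simp only [neg_neg]
  rw [← hsq (norm_nonneg _), hnorm, Real.mul_rpow (by positivity) (by positivity), hsq hc.le]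

lemma norm_cpow_le_rpow_re_mul_exp (u a : ℂ) (hu : u ≠ 0) :
    ‖u ^ a‖ ≤ ‖u‖ ^ a.re * Real.exp (Real.pi * |a.im|) := by
  rw [Complex.norm_cpow_of_ne_zero hu, div_eq_mul_inv, ← Real.exp_neg]
  gcongr
  calc -(u.arg * a.im) ≤ |u.arg| * |a.im| := by rw [← abs_mul]; exact neg_le_abs _
    _ ≤ Real.pi * |a.im| := by gcongr; exact Complex.abs_arg_le_pi u

lemma continuous_vertical_cpow {c : ℝ} (hc : 0 < c) (a : ℂ) :
    Continuous fun v : ℝ => (c + v * I : ℂ) ^ a :=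
  Continuous.cpow (by fun_prop) continuous_const fun v => Or.inl (by simpa using hc)

lemma verticalIntegrable_cpow {a : ℂ} {c : ℝ} (ha : a.re < -1) (hc : 0 < c) :
    Complex.VerticalIntegrable (fun u => u ^ a) c :=
  ((integrable_norm_vertical_rpow ha hc).mul_const (Real.exp (Real.pi * |a.im|))).mono'
    (continuous_vertical_cpow hc a).aestronglyMeasurable
    (ae_of_all _ fun v => norm_cpow_le_rpow_re_mul_exp _ a
      (norm_pos_iff.1 (hc.trans_le (le_norm_vertical c v))))

end Bromwich

section GammaIntegral

lemma integrableOn_rpow_mul_exp_neg_mul {s b : ℝ} (hs : -1 < s) (hb : 0 < b) :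
    IntegrableOn (fun y : ℝ => y ^ s * Real.exp (-(b * y))) (Ioi 0) := by
  simpa using integrableOn_rpow_mul_exp_neg_mul_rpow hs one_pos hb

lemma norm_cpow_mul_cexp {y : ℝ} (hy : 0 < y) (a z : ℂ) :
    ‖(y : ℂ) ^ a * Complex.exp (-(z * y))‖ = y ^ a.re * Real.exp (-(z.re * y)) := by
  rw [norm_mul, Complex.norm_cpow_eq_rpow_re_of_pos hy, Complex.norm_exp, Complex.neg_re,
    Complex.re_mul_ofReal]

lemma aestronglyMeasurable_cpow_mul_cexp (a z : ℂ) :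
    AEStronglyMeasurable (fun y : ℝ => (y : ℂ) ^ a * Complex.exp (-(z * y)))
      (volume.restrict (Ioi 0)) :=
  Measurable.aestronglyMeasurable (by fun_prop)

lemma mellinConvergent_cexp_neg_mul {a z : ℂ} (ha : 0 < a.re) (hz : 0 < z.re) :
    MellinConvergent (fun y : ℝ => Complex.exp (-(z * y))) a :=
  (integrableOn_rpow_mul_exp_neg_mul (by simpa using ha : -1 < (a - 1).re) hz).mono'
    (aestronglyMeasurable_cpow_mul_cexp (a - 1) z)
    ((ae_restrict_mem measurableSet_Ioi).mono fun _ hy => (norm_cpow_mul_cexp hy _ z).le)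

lemma differentiableAt_mellin_cexp_neg_mul {a z : ℂ} (ha : 0 < a.re) (hz : 0 < z.re) :
    DifferentiableAt ℂ (fun z : ℂ => mellin (fun y : ℝ => Complex.exp (-(z * y))) a) z := by
  have h := hasDerivAt_integral_of_dominated_loc_of_deriv_le
    (μ := volume.restrict (Ioi (0 : ℝ))) (x₀ := z) (s := {w : ℂ | z.re / 2 < w.re})
    (F := fun w (y : ℝ) => (y : ℂ) ^ (a - 1) * Complex.exp (-(w * y)))
    (F' := fun w (y : ℝ) => (y : ℂ) ^ (a - 1) * (Complex.exp (-(w * y)) * -(1 * y)))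
    (bound := fun y => y ^ a.re * Real.exp (-(z.re / 2 * y)))
    ((isOpen_lt continuous_const Complex.continuous_re).mem_nhds
      (show z.re / 2 < z.re by linarith))
    (Eventually.of_forall fun w => aestronglyMeasurable_cpow_mul_cexp (a - 1) w)
    (mellinConvergent_cexp_neg_mul ha hz)
    (Measurable.aestronglyMeasurable (by fun_prop))
    ?_ (integrableOn_rpow_mul_exp_neg_mul (by linarith) (by linarith))
    (ae_of_all _ fun y w _ => ((((hasDerivAt_id w).mul_const (y : ℂ)).neg).cexp).const_mul _)
  · exact h.2.differentiableAt
  · filter_upwards [ae_restrict_mem measurableSet_Ioi] with y (hy : 0 < y) w (hw : z.re / 2 < w.re)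
    have hpow : y ^ a.re = y ^ (a - 1).re * y := by
      rw [← Real.rpow_add_one hy.ne']
      simp
    rw [← mul_assoc, norm_mul, norm_cpow_mul_cexp hy, norm_neg, one_mul, Complex.norm_real,
      Real.norm_of_nonneg hy.le, hpow, mul_right_comm]
    gcongr

lemma mellin_cexp_neg_mul {a z : ℂ} (ha : 0 < a.re) (hz : 0 < z.re) :
    mellin (fun y : ℝ => Complex.exp (-(z * y))) a = Complex.Gamma a * z ^ (-a) := by
  have hopen : IsOpen {w : ℂ | 0 < w.re} := isOpen_lt continuous_const Complex.continuous_re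
  have hleft : AnalyticOnNhd ℂ (fun z : ℂ => mellin (fun y : ℝ => Complex.exp (-(z * y))) a)
      {w : ℂ | 0 < w.re} := DifferentiableOn.analyticOnNhd (fun w hw =>
    (differentiableAt_mellin_cexp_neg_mul ha hw).differentiableWithinAt) hopen
  have hright : AnalyticOnNhd ℂ (fun z : ℂ => Complex.Gamma a * z ^ (-a)) {w : ℂ | 0 < w.re} :=
    DifferentiableOn.analyticOnNhd (fun w hw => (((hasDerivAt_id w).cpow_const
      (Or.inl hw)).const_mul _).differentiableAt.differentiableWithinAt) hopen
  have hreal (r : ℝ) (hr : 0 < r) : mellin (fun y : ℝ => Complex.exp (-(r * y))) a =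
      Complex.Gamma a * (r : ℂ) ^ (-a) := by
    have hGamma := Complex.integral_cpow_mul_exp_neg_mul_Ioi ha hr
    rw [one_div, Complex.inv_cpow _ _ (by simp [Complex.arg_ofReal_of_nonneg hr.le,
      Real.pi_ne_zero.symm]), ← Complex.cpow_neg] at hGamma
    rw [mul_comm, ← hGamma]
    rfl
  have hcast : Tendsto ((↑) : ℝ → ℂ) (𝓝[≠] 1) (𝓝[≠] 1) := by
    simpa using (Complex.continuous_ofReal.continuousWithinAt (s := {1}ᶜ)
      (x := 1)).tendsto_nhdsWithin fun r (hr : r ≠ 1) => Complex.ofReal_ne_one.2 hr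
  refine hleft.eqOn_of_preconnected_of_frequently_eq hright
    (convex_halfSpace_re_gt 0).isPreconnected (z₀ := 1) (by simp) (hcast.frequently ?_) hz
  exact (eventually_nhdsWithin_of_eventually_nhds (eventually_gt_nhds one_pos)).mono hreal
    |>.frequently

lemma hasMellin_cexp_neg_mul {a z : ℂ} (ha : 0 < a.re) (hz : 0 < z.re) :
    HasMellin (fun y : ℝ => Complex.exp (-(z * y))) a (Complex.Gamma a * z ^ (-a)) :=
  ⟨mellinConvergent_cexp_neg_mul ha hz, mellin_cexp_neg_mul ha hz⟩

lemma hasMellin_pow_mul_cexp_neg_mul {s z : ℂ} (hs : 0 < s.re) (hz : 0 < z.re) (n : ℕ) :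
    HasMellin (fun y : ℝ => (y : ℂ) ^ n * Complex.exp (-(z * y))) s
      (Complex.Gamma (s + n) * z ^ (-(s + n))) := by
  have h := hasMellin_cexp_neg_mul (a := s + n) (z := z)
    (by rw [Complex.add_re, Complex.natCast_re]; positivity) hz
  have hmellin := mellin_cpow_smul (fun y : ℝ => Complex.exp (-(z * y))) s n
  exact ⟨by simpa using MellinConvergent.cpow_smul.2 h.1, by simpa [h.2] using hmellin⟩

lemma bromwich_cpow_neg {a : ℂ} {c x : ℝ} (ha : 1 < a.re) (hc : 0 < c) (hx : 0 < x) :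
    bromwich c (fun u => u ^ (-a)) x = (x : ℂ) ^ (a - 1) / Complex.Gamma a := by
  have ha0 : 0 < a.re := by linarith
  have hGamma : Complex.Gamma a ≠ 0 := Complex.Gamma_ne_zero_of_re_pos ha0
  set f : ℝ → ℂ := (Ioi 0).indicator fun y => (y : ℂ) ^ (a - 1) / Complex.Gamma a
  have hf {y : ℝ} (hy : 0 < y) : f y = (y : ℂ) ^ (a - 1) / Complex.Gamma a :=
    indicator_of_mem (mem_Ioi.2 hy) _
  have hmul (u : ℂ) : (fun y : ℝ => Complex.exp (-(u * y)) * f y) = (Ioi (0 : ℝ)).indicator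
      fun y => (Complex.Gamma a)⁻¹ * ((y : ℂ) ^ (a - 1) * Complex.exp (-(u * y))) := by
    ext y
    rw [← indicator_mul_right (i := y) (Ioi (0 : ℝ)) fun y : ℝ => Complex.exp (-(u * y))]
    congr with y
    ring
  have hlaplace (u : ℂ) (hu : 0 < u.re) :
      ∫ y : ℝ, Complex.exp (-(u * y)) * f y = u ^ (-a) := by
    rw [hmul, integral_indicator measurableSet_Ioi, integral_const_mul]
    have h := mellin_cexp_neg_mul ha0 hu
    simp only [mellin, smul_eq_mul] at h
    rw [h, inv_mul_cancel_left₀ hGamma]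
  have hint : Integrable fun y : ℝ => Complex.exp (-(c * y)) * f y := by
    rw [hmul, integrable_indicator_iff measurableSet_Ioi]
    exact (mellinConvergent_cexp_neg_mul ha0 (z := c) (by simpa using hc)).const_mul _
  have hline (v : ℝ) : ∫ y : ℝ, Complex.exp (-((c + v * I) * y)) * f y = (c + v * I) ^ (-a) :=
    hlaplace _ (by simpa using hc)
  have hcont : ContinuousAt f x := by
    have hpow : ContinuousAt (fun y : ℝ => (y : ℂ) ^ (a - 1) / Complex.Gamma a) x :=
      (Complex.continuousAt_ofReal_cpow_const x (a - 1) (Or.inr hx.ne')).div_const _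
    exact hpow.congr ((eventually_gt_nhds hx).mono fun y hy => (hf hy).symm)
  have hinv := bromwich_laplace_eq hint
    ((verticalIntegrable_cpow (a := -a) (by simpa using ha) hc).congr
      (ae_of_all _ fun v => (hline v).symm)) hcont
  rw [← hf hx, ← hinv, bromwich, bromwich]
  simp only [hline]

end GammaIntegral

section StableExp

variable {α : ℝ}

/-- The Laplace transform `exp (-y u^α)` of the `α`-stable subordinator at time `y`. -/
noncomputable def stableExp (α y : ℝ) (u : ℂ) : ℂ := Complex.exp (-(y * u ^ (α : ℂ)))

/-- The first derivative of `stableExp α y` on the right half-plane. -/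
noncomputable def stableExpDeriv (α y : ℝ) (u : ℂ) : ℂ :=
  -(y * α * u ^ (α - 1 : ℂ)) * stableExp α y u

/-- The second derivative of `stableExp α y` on the right half-plane. In contrast to the first one,
it is dominated on vertical lines by an integrable function of `u` times a function of `y`. -/
noncomputable def stableExpDeriv₂ (α y : ℝ) (u : ℂ) : ℂ :=
  (y * (α * (1 - α)) * u ^ (α - 2 : ℂ) + (y * α * u ^ (α - 1 : ℂ)) ^ 2) * stableExp α y u

lemma hasDerivAt_stableExp (α y : ℝ) {u : ℂ} (hu : 0 < u.re) :
    HasDerivAt (stableExp α y) (stableExpDeriv α y u) u := by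
  have h := (((hasDerivAt_id u).cpow_const (c := (α : ℂ)) (Or.inl hu)).const_mul (y : ℂ)).neg.cexp
  refine h.congr_deriv ?_
  simp only [stableExpDeriv, stableExp, id, Pi.neg_apply]
  ring

lemma hasDerivAt_stableExpDeriv (α y : ℝ) {u : ℂ} (hu : 0 < u.re) :
    HasDerivAt (stableExpDeriv α y) (stableExpDeriv₂ α y u) u := by
  have hcpow := (((hasDerivAt_id u).cpow_const (c := (α - 1 : ℂ)) (Or.inl hu)).const_mul
    (y * α : ℂ)).neg
  refine (hcpow.mul (hasDerivAt_stableExp α y hu)).congr_deriv ?_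
  have hexp : (α - 1 - 1 : ℂ) = α - 2 := by ring
  simp only [stableExpDeriv₂, stableExpDeriv, id, Pi.neg_apply, hexp]
  ring

lemma continuousOn_stableExp (hα0 : 0 < α) (y : ℝ) :
    ContinuousOn (stableExp α y) {u | 0 ≤ u.re} := by
  have := continuousOn_cpow_const (a := (α : ℂ)) (by simpa using hα0)
  unfold stableExp
  fun_prop

lemma stableExp_conj (α y : ℝ) {u : ℂ} (hu : 0 ≤ u.re) :
    stableExp α y (starRingEnd ℂ u) = starRingEnd ℂ (stableExp α y u) := by
  have harg : u.arg ≠ Real.pi := fun h => by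
    have := abs_le.1 (Complex.abs_arg_le_pi_div_two_iff.2 hu)
    linarith [Real.pi_pos]
  rw [stableExp, stableExp, Complex.conj_cpow _ _ harg, ← Complex.exp_conj]
  simp

lemma norm_stableExp_le {y : ℝ} (hα0 : 0 < α) (hα2 : α ≤ 2) (hy : 0 ≤ y) {u : ℂ}
    (hu : 0 ≤ u.re) :
    ‖stableExp α y u‖ ≤ Real.exp (-(y * Real.cos (α * (Real.pi / 2)) * ‖u‖ ^ α)) := by
  rw [stableExp, Complex.norm_exp, Complex.neg_re, Complex.re_ofReal_mul, mul_assoc,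
    mul_comm (Real.cos _)]
  gcongr
  exact norm_rpow_mul_cos_le_re_cpow hα0 hα2 hu

lemma one_add_mul_exp_neg_le {κ w : ℝ} (hκ : 0 < κ) (hw : 0 ≤ w) :
    (1 + w) * Real.exp (-(κ * w)) ≤ (1 + 2 / κ) * Real.exp (-(κ * w / 2)) := by
  have hsplit : Real.exp (κ * w) = Real.exp (κ * w / 2) * Real.exp (κ * w / 2) := by
    rw [← Real.exp_add, add_halves]
  have hexp : 1 + κ * w / 2 ≤ Real.exp (κ * w / 2) := by
    linarith [Real.add_one_le_exp (κ * w / 2)]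
  have hpoly : 1 + w ≤ (1 + 2 / κ) * (1 + κ * w / 2) := by
    have hexpand : (1 + 2 / κ) * (1 + κ * w / 2) = 1 + w + (2 / κ + κ * w / 2) := by
      field_simp; ring
    rw [hexpand]
    exact le_add_of_nonneg_right (by positivity)
  rw [Real.exp_neg, Real.exp_neg, hsplit, mul_inv, ← mul_assoc]
  gcongr
  rw [← div_eq_mul_inv, div_le_iff₀ (Real.exp_pos _)]
  exact hpoly.trans (by gcongr)

lemma norm_stableExpDeriv₂_factor_le {y : ℝ} (hα0 : 0 < α) (hα1 : α < 1) (hy : 0 ≤ y) {u : ℂ}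
    (hu : u ≠ 0) :
    ‖(y * (α * (1 - α)) * u ^ (α - 2 : ℂ) + (y * α * u ^ (α - 1 : ℂ)) ^ 2 : ℂ)‖ ≤
      y * ‖u‖ ^ (α - 2) * (1 + y * ‖u‖ ^ α) := by
  have hr : 0 < ‖u‖ := norm_pos_iff.2 hu
  have hsq : (‖u‖ ^ (α - 1)) ^ 2 = ‖u‖ ^ (α - 2) * ‖u‖ ^ α := by
    rw [← Real.rpow_natCast, ← Real.rpow_mul hr.le, ← Real.rpow_add hr]
    congr 1
    push_cast
    ring
  have hnorm₁ : ‖(y * (α * (1 - α)) * u ^ (α - 2 : ℂ) : ℂ)‖ =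
      y * ‖u‖ ^ (α - 2) * (α * (1 - α)) := by
    have hcpow : ‖u ^ (α - 2 : ℂ)‖ = ‖u‖ ^ (α - 2) := mod_cast Complex.norm_cpow_real u (α - 2)
    have hcoeff : ‖(α * (1 - α) : ℂ)‖ = α * (1 - α) := by
      exact_mod_cast Real.norm_of_nonneg (mul_nonneg hα0.le (sub_nonneg.2 hα1.le))
    rw [norm_mul, norm_mul, hcpow, hcoeff, Complex.norm_of_nonneg hy]
    ring
  have hnorm₂ : ‖((y * α * u ^ (α - 1 : ℂ)) ^ 2 : ℂ)‖ =
      y * ‖u‖ ^ (α - 2) * (α ^ 2 * (y * ‖u‖ ^ α)) := by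
    have hcpow : ‖u ^ (α - 1 : ℂ)‖ = ‖u‖ ^ (α - 1) := mod_cast Complex.norm_cpow_real u (α - 1)
    rw [norm_pow, norm_mul, norm_mul, hcpow, Complex.norm_of_nonneg hy,
      Complex.norm_of_nonneg hα0.le, mul_pow, hsq]
    ring
  refine (norm_add_le _ _).trans ?_
  rw [hnorm₁, hnorm₂, ← mul_add]
  refine mul_le_mul_of_nonneg_left (add_le_add (by nlinarith) ?_) (by positivity)
  exact mul_le_of_le_one_left (by positivity) (pow_le_one₀ hα0.le hα1.le)

lemma norm_stableExpDeriv₂_le {y : ℝ} (hα0 : 0 < α) (hα1 : α < 1) (hy : 0 ≤ y) {u : ℂ}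
    (hu : 0 < u.re) :
    ‖stableExpDeriv₂ α y u‖ ≤ (1 + 2 / Real.cos (α * (Real.pi / 2))) *
      (y * Real.exp (-(Real.cos (α * (Real.pi / 2)) * ‖u‖ ^ α / 2 * y))) * ‖u‖ ^ (α - 2) := by
  have hκ := cos_mul_pi_div_two_pos (abs_lt.2 ⟨by linarith, hα1⟩)
  set κ := Real.cos (α * (Real.pi / 2))
  have hu0 : u ≠ 0 := fun h => by simp [h] at hu
  calc ‖stableExpDeriv₂ α y u‖
      ≤ y * ‖u‖ ^ (α - 2) * (1 + y * ‖u‖ ^ α) * Real.exp (-(y * κ * ‖u‖ ^ α)) := by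
        rw [stableExpDeriv₂, norm_mul]
        gcongr
        · exact norm_stableExpDeriv₂_factor_le hα0 hα1 hy hu0
        · exact norm_stableExp_le hα0 (by linarith) hy hu.le
    _ = y * ‖u‖ ^ (α - 2) * ((1 + y * ‖u‖ ^ α) * Real.exp (-(κ * (y * ‖u‖ ^ α)))) := by
        ring_nf
    _ ≤ y * ‖u‖ ^ (α - 2) * ((1 + 2 / κ) * Real.exp (-(κ * (y * ‖u‖ ^ α) / 2))) :=
        mul_le_mul_of_nonneg_left (one_add_mul_exp_neg_le hκ (by positivity)) (by positivity)
    _ = _ := by ring_nf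

lemma norm_stableExpDeriv₂_vertical_le {y c : ℝ} (hα0 : 0 < α) (hα1 : α < 1) (hy : 0 ≤ y)
    (hc : 0 < c) (v : ℝ) :
    ‖stableExpDeriv₂ α y (c + v * I)‖ ≤ (1 + 2 / Real.cos (α * (Real.pi / 2))) *
      (y * Real.exp (-(Real.cos (α * (Real.pi / 2)) * c ^ α / 2 * y))) *
        ‖(c + v * I : ℂ)‖ ^ (α - 2) := by
  have hκ := cos_mul_pi_div_two_pos (abs_lt.2 ⟨by linarith, hα1⟩)
  refine (norm_stableExpDeriv₂_le hα0 hα1 hy (by simpa using hc)).trans ?_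
  gcongr
  exact le_norm_vertical c v

end StableExp

section StableDensity

variable {α c y : ℝ}

lemma norm_stableExp_le_exp_abs_im (hα0 : 0 < α) (hα1 : α < 1) (hy : 0 ≤ y) {u : ℂ}
    (hu : 0 ≤ u.re) :
    ‖stableExp α y u‖ ≤ Real.exp (-(y * Real.cos (α * (Real.pi / 2)) * |u.im| ^ α)) := by
  have hκ := cos_mul_pi_div_two_pos (abs_lt.2 ⟨by linarith, hα1⟩)
  refine (norm_stableExp_le hα0 (by linarith) hy hu).trans ?_
  gcongr
  exact Complex.abs_im_le_norm u

lemma integrable_exp_neg_mul_abs_rpow {b : ℝ} (hα0 : 0 < α) (hb : 0 < b) :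
    Integrable fun v : ℝ => Real.exp (-(b * |v| ^ α)) := by
  have hright : IntegrableOn (fun v : ℝ => Real.exp (-(b * |v| ^ α))) (Ioi 0) :=
    (integrableOn_rpow_mul_exp_neg_mul_rpow (s := 0) (by norm_num) hα0 hb).congr_fun
      (fun v hv => by simp [abs_of_pos (mem_Ioi.1 hv)]) measurableSet_Ioi
  have hleft : IntegrableOn (fun v : ℝ => Real.exp (-(b * |v| ^ α))) (Iic 0) := by
    rw [integrableOn_Iic_iff_integrableOn_Iio]
    rw [← neg_zero] at hright
    simpa only [abs_neg] using hright.comp_neg_Iio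
  rw [← integrableOn_univ, ← Iic_union_Ioi (a := (0 : ℝ))]
  exact hleft.union hright

lemma continuous_stableExp_vertical (hα0 : 0 < α) (y : ℝ) (hc : 0 ≤ c) :
    Continuous fun v : ℝ => stableExp α y (c + v * I) :=
  (continuousOn_stableExp hα0 y).comp_continuous (by fun_prop) fun v => by simpa using hc

lemma verticalIntegrable_stableExp (hα0 : 0 < α) (hα1 : α < 1) (hy : 0 < y) (hc : 0 ≤ c) :
    Complex.VerticalIntegrable (stableExp α y) c := by
  have hκ := cos_mul_pi_div_two_pos (abs_lt.2 ⟨by linarith, hα1⟩)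
  refine (integrable_exp_neg_mul_abs_rpow hα0 (mul_pos hy hκ)).mono'
    (continuous_stableExp_vertical hα0 y hc).aestronglyMeasurable (ae_of_all _ fun v => ?_)
  simpa using norm_stableExp_le_exp_abs_im hα0 hα1 hy.le (u := c + v * I) (by simpa using hc)

lemma verticalIntegrable_stableExpDeriv (hα0 : 0 < α) (hα1 : α < 1) (hy : 0 < y) (hc : 0 < c) :
    Complex.VerticalIntegrable (stableExpDeriv α y) c := by
  refine (verticalIntegrable_stableExp hα0 hα1 hy hc.le).bdd_mul (c := ‖(y * α : ℂ)‖ * c ^ (α - 1))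
    (continuous_const.mul (continuous_vertical_cpow hc (α - 1))).neg.aestronglyMeasurable
    (ae_of_all _ fun v => ?_)
  have hcpow : ‖(c + v * I : ℂ) ^ (α - 1 : ℂ)‖ = ‖(c + v * I : ℂ)‖ ^ (α - 1) :=
    mod_cast Complex.norm_cpow_real (c + v * I) (α - 1)
  rw [norm_neg, norm_mul, hcpow]
  exact mul_le_mul_of_nonneg_left
    (Real.rpow_le_rpow_of_nonpos hc (le_norm_vertical c v) (by linarith)) (norm_nonneg _)

lemma measurable_stableExpDeriv₂_vertical (α c : ℝ) :
    Measurable fun p : ℝ × ℝ => stableExpDeriv₂ α p.1 (c + p.2 * I) := by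
  unfold stableExpDeriv₂ stableExp
  fun_prop

lemma verticalIntegrable_stableExpDeriv₂ (hα0 : 0 < α) (hα1 : α < 1) (hy : 0 ≤ y) (hc : 0 < c) :
    Complex.VerticalIntegrable (stableExpDeriv₂ α y) c :=
  ((integrable_norm_vertical_rpow (a := α - 2) (by linarith) hc).const_mul _).mono'
    ((measurable_stableExpDeriv₂_vertical α c).comp measurable_prodMk_left).aestronglyMeasurable
    (ae_of_all _ fun v => norm_stableExpDeriv₂_vertical_le hα0 hα1 hy hc v)

lemma bromwich_stableExp_eq_bromwich_zero (hα0 : 0 < α) (hα1 : α < 1) (hy : 0 < y) (hc : 0 ≤ c)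
    (x : ℝ) : bromwich c (stableExp α y) x = bromwich 0 (stableExp α y) x := by
  have hκ := cos_mul_pi_div_two_pos (abs_lt.2 ⟨by linarith, hα1⟩)
  set κ := Real.cos (α * (Real.pi / 2))
  have hm : Tendsto (fun T : ℝ => Real.exp (c * |x|) * Real.exp (-(y * κ * T ^ α)))
      atTop (𝓝 0) := by
    simpa using (Real.tendsto_exp_neg_atTop_nhds_zero.comp
      ((tendsto_rpow_atTop hα0).const_mul_atTop (mul_pos hy hκ))).const_mul (Real.exp (c * |x|))
  have hf (u : ℂ) (hu : u.re ∈ Icc 0 c) : ‖Complex.exp (u * x) * stableExp α y u‖ ≤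
      Real.exp (c * |x|) * Real.exp (-(y * κ * |u.im| ^ α)) := by
    rw [norm_mul, Complex.norm_exp, Complex.re_mul_ofReal]
    refine mul_le_mul (Real.exp_le_exp.2 ?_) (norm_stableExp_le_exp_abs_im hα0 hα1 hy.le hu.1)
      (norm_nonneg _) (Real.exp_nonneg _)
    exact (mul_le_mul_of_nonneg_left (le_abs_self x) hu.1).trans
      (mul_le_mul_of_nonneg_right hu.2 (abs_nonneg x))
  have hcont : ContinuousOn (fun u => Complex.exp (u * x) * stableExp α y u)
      (Complex.re ⁻¹' Icc 0 c) :=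
    (Continuous.continuousOn (by fun_prop)).mul
      ((continuousOn_stableExp hα0 y).mono fun u hu => hu.1)
  have hdiff : DifferentiableOn ℂ (fun u => Complex.exp (u * x) * stableExp α y u)
      (Complex.re ⁻¹' Ioo 0 c) := fun u hu =>
    (DifferentiableAt.mul (by fun_prop)
      (hasDerivAt_stableExp α y hu.1).differentiableAt).differentiableWithinAt
  have hline {b : ℝ} (hb : 0 ≤ b) :=
    verticalIntegrable_exp_mul (verticalIntegrable_stableExp hα0 hα1 hy hb) x
  rw [bromwich, bromwich, integral_vertical_line_eq hc hcont hdiff hm hf (hline le_rfl) (hline hc)]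

lemma ofReal_stableDensity_eq_bromwich (hα0 : 0 < α) (hα1 : α < 1) (hy : 0 < y) (hc : 0 ≤ c)
    (x : ℝ) : (stableDensity α x y : ℂ) = bromwich c (stableExp α y) x := by
  have hre : stableDensity α x y = (bromwich 0 (stableExp α y) x).re := by
    have hpi : (2 * Real.pi : ℂ)⁻¹ = ((2 * Real.pi)⁻¹ : ℝ) := by push_cast; rfl
    rw [bromwich, stableDensity, hpi, Complex.re_ofReal_mul, ← integral_neg_eq_self]
    congr 3 with v
    simp [stableExp, mul_comm I]
  rw [bromwich_stableExp_eq_bromwich_zero hα0 hα1 hy hc, hre]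
  exact Complex.conj_eq_iff_re.1 (conj_bromwich (fun u hu => stableExp_conj α y hu.ge) x)

lemma sq_mul_stableDensity (hα0 : 0 < α) (hα1 : α < 1) (hy : 0 < y) (hc : 0 < c) (x : ℝ) :
    (x : ℂ) ^ 2 * stableDensity α x y = bromwich c (stableExpDeriv₂ α y) x := by
  have hre {u : ℂ} (hu : u.re = c) : 0 < u.re := hu ▸ hc
  have hint := verticalIntegrable_stableExpDeriv hα0 hα1 hy hc
  rw [ofReal_stableDensity_eq_bromwich hα0 hα1 hy hc.le, sq, mul_assoc,
    mul_bromwich_of_hasDerivAt (fun u hu => hasDerivAt_stableExp α y (hre hu))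
      (verticalIntegrable_stableExp hα0 hα1 hy hc.le) hint, mul_neg,
    mul_bromwich_of_hasDerivAt (fun u hu => hasDerivAt_stableExpDeriv α y (hre hu)) hint
      (verticalIntegrable_stableExpDeriv₂ hα0 hα1 hy.le hc), neg_neg]

lemma abs_stableDensity_le {x : ℝ} (hα0 : 0 < α) (hα1 : α < 1) (hx : x ≠ 0) (hc : 0 < c)
    (hy : 0 < y) :
    |stableDensity α x y| ≤ (2 * Real.pi)⁻¹ * Real.exp (c * x) *
      (1 + 2 / Real.cos (α * (Real.pi / 2))) * (∫ v : ℝ, ‖(c + v * I : ℂ)‖ ^ (α - 2)) / x ^ 2 *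
        (y * Real.exp (-(Real.cos (α * (Real.pi / 2)) * c ^ α / 2 * y))) := by
  have hB := (integrable_norm_vertical_rpow (a := α - 2) (by linarith) hc).const_mul
    ((1 + 2 / Real.cos (α * (Real.pi / 2))) *
      (y * Real.exp (-(Real.cos (α * (Real.pi / 2)) * c ^ α / 2 * y))))
  have h := norm_bromwich_le hB (norm_stableExpDeriv₂_vertical_le hα0 hα1 hy.le hc) x
  rw [← sq_mul_stableDensity hα0 hα1 hy hc, norm_mul, norm_pow, Complex.norm_real,
    Complex.norm_real, Real.norm_eq_abs, Real.norm_eq_abs, sq_abs, integral_const_mul] at h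
  rw [div_mul_eq_mul_div, le_div_iff₀ (by positivity), mul_comm]
  exact h.trans_eq (by ring)

lemma exists_abs_stableDensity_le {x : ℝ} (hα0 : 0 < α) (hα1 : α < 1) (hx : x ≠ 0) (k : ℝ) :
    ∃ C, ∀ y, 0 < y → |stableDensity α x y| ≤ C * (y * Real.exp (-(k * y))) := by
  have hκ := cos_mul_pi_div_two_pos (abs_lt.2 ⟨by linarith, hα1⟩)
  -- The decay rate on the line `Re u = c` is a multiple of `c ^ α`, hence as large as we like.
  have hlim := (((tendsto_rpow_atTop hα0).const_mul_atTop hκ).atTop_div_const two_pos)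
  obtain ⟨c, hk, hc⟩ := ((hlim.eventually_ge_atTop k).and (eventually_gt_atTop 0)).exists
  exact ⟨_, fun y hy => (abs_stableDensity_le hα0 hα1 hx hc hy).trans (by gcongr)⟩

lemma exists_norm_stableDensity_le_rpow {x : ℝ} (hα0 : 0 < α) (hα1 : α < 1) (hx : x ≠ 0) :
    ∃ C, ∀ y, 0 < y → ‖(stableDensity α x y : ℂ)‖ ≤ C * y ^ (1 : ℝ) := by
  obtain ⟨C, hC⟩ := exists_abs_stableDensity_le hα0 hα1 hx 0
  exact ⟨C, fun y hy => by simpa using hC y hy⟩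

lemma measurable_stableDensity (α x : ℝ) : Measurable (stableDensity α x) := by
  have h : StronglyMeasurable (Function.uncurry fun y θ : ℝ => Complex.exp (-(I * θ * x)) *
      Complex.exp (-((y : ℂ) * (-(I * θ)) ^ (α : ℂ)))) := by
    unfold Function.uncurry
    exact Measurable.stronglyMeasurable (by fun_prop)
  exact (Complex.measurable_re.comp h.integral_prod_right.measurable).const_mul _

end StableDensity

section StableMellin

variable {α : ℝ} {s : ℂ}

lemma cpow_cpow_of_re_pos (hα : |α| ≤ 1) {u : ℂ} (hu : 0 < u.re) (b : ℂ) :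
    (u ^ (α : ℂ)) ^ b = u ^ (α * b) := by
  have harg := abs_lt.1 (Complex.abs_arg_lt_pi_div_two_iff.2 (Or.inl hu))
  have hbound : |u.arg * α| ≤ Real.pi / 2 := by
    rw [abs_mul]
    exact (mul_le_of_le_one_right (abs_nonneg _) hα).trans (abs_le.2 ⟨harg.1.le, harg.2.le⟩)
  have him := abs_le.1 hbound
  rw [Complex.cpow_mul] <;> rw [Complex.im_mul_ofReal, Complex.log_im] <;>
    linarith [Real.pi_pos]

lemma Gamma_add_two (hs : 0 < s.re) :
    Complex.Gamma (s + 2) = (s + 1) * s * Complex.Gamma s := by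
  have hs0 : s ≠ 0 := fun h => by simp [h] at hs
  have hs1 : s + 1 ≠ 0 := fun h => by
    have hre : s.re + 1 = 0 := by simpa using congrArg Complex.re h
    linarith
  rw [← one_add_one_eq_two, ← add_assoc, Complex.Gamma_add_one _ hs1, Complex.Gamma_add_one _ hs0,
    mul_assoc]

lemma hasMellin_stableExpDeriv₂ (hα : |α| < 1) (hs : 0 < s.re) {u : ℂ} (hu : 0 < u.re) :
    HasMellin (fun y => stableExpDeriv₂ α y u) s
      (Complex.Gamma s * (α * s) * (α * s + 1) * u ^ (-(α * s + 2))) := by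
  have hu0 : u ≠ 0 := fun h => by simp [h] at hu
  have hpow (n : ℕ) := hasMellin_pow_mul_cexp_neg_mul hs (re_cpow_pos hα hu) n
  have h := hasMellin_add ((hpow 1).1.const_smul (α * (1 - α) * u ^ (α - 2 : ℂ)))
    ((hpow 2).1.const_smul ((α * u ^ (α - 1 : ℂ)) ^ 2))
  rw [mellin_const_smul, mellin_const_smul, (hpow 1).2, (hpow 2).2] at h
  convert h using 1
  · ext y
    simp only [stableExpDeriv₂, stableExp, smul_eq_mul, mul_comm (u ^ (α : ℂ))]
    ring
  · have hs0 : s ≠ 0 := fun h => by simp [h] at hs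
    have hcpow₁ : u ^ (α - 2 : ℂ) * u ^ (α * -(s + 1) : ℂ) = u ^ (-(α * s + 2)) := by
      rw [← Complex.cpow_add _ _ hu0]; congr 1; ring
    have hcpow₂ : (u ^ (α - 1 : ℂ)) ^ 2 * u ^ (α * -(s + 2) : ℂ) = u ^ (-(α * s + 2)) := by
      rw [sq, ← Complex.cpow_add _ _ hu0, ← Complex.cpow_add _ _ hu0]; congr 1; ring
    rw [cpow_cpow_of_re_pos hα.le hu, cpow_cpow_of_re_pos hα.le hu]
    push_cast
    rw [Complex.Gamma_add_one s hs0, Gamma_add_two hs, smul_eq_mul, smul_eq_mul, mul_pow]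
    linear_combination (-(α * (1 - α) * (s * Complex.Gamma s)) : ℂ) * hcpow₁ -
      α ^ 2 * ((s + 1) * (s * Complex.Gamma s)) * hcpow₂

lemma integrable_cpow_mul_stableExpDeriv₂_vertical {c : ℝ} (hα0 : 0 < α) (hα1 : α < 1)
    (hs : 0 < s.re) (hc : 0 < c) :
    Integrable (fun p : ℝ × ℝ => (p.1 : ℂ) ^ (s - 1) * stableExpDeriv₂ α p.1 (c + p.2 * I))
      ((volume.restrict (Ioi 0)).prod volume) := by
  have hκ := cos_mul_pi_div_two_pos (abs_lt.2 ⟨by linarith, hα1⟩)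
  set κ := Real.cos (α * (Real.pi / 2))
  have hbound := ((integrableOn_rpow_mul_exp_neg_mul (s := s.re) (b := κ * c ^ α / 2)
    (by linarith) (by positivity)).const_mul (1 + 2 / κ)).mul_prod
      (integrable_norm_vertical_rpow (a := α - 2) (by linarith) hc)
  refine hbound.mono' (Measurable.aestronglyMeasurable
    ((by fun_prop : Measurable fun p : ℝ × ℝ => (p.1 : ℂ) ^ (s - 1)).mul
      (measurable_stableExpDeriv₂_vertical α c))) ?_
  have hpos : ∀ᵐ p : ℝ × ℝ ∂(volume.restrict (Ioi 0)).prod volume, 0 < p.1 :=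
    Measure.quasiMeasurePreserving_fst.ae (ae_restrict_mem measurableSet_Ioi)
  filter_upwards [hpos] with p hp
  have hpow : p.1 ^ s.re = p.1 ^ (s.re - 1) * p.1 := by
    rw [← Real.rpow_add_one hp.ne', sub_add_cancel]
  rw [norm_mul, Complex.norm_cpow_eq_rpow_re_of_pos hp, Complex.sub_re, Complex.one_re]
  calc _ ≤ p.1 ^ (s.re - 1) * _ := mul_le_mul_of_nonneg_left
        (norm_stableExpDeriv₂_vertical_le hα0 hα1 hp.le hc p.2) (by positivity)
    _ = _ := by rw [hpow]; ring

lemma hasMellin_congr {E : Type*} [NormedAddCommGroup E] [NormedSpace ℂ E] {f g : ℝ → E} {m : E}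
    (h : HasMellin f s m) (hfg : EqOn f g (Ioi 0)) : HasMellin g s m := by
  have hsmul : EqOn (fun y : ℝ => (y : ℂ) ^ (s - 1) • f y) (fun y => (y : ℂ) ^ (s - 1) • g y)
      (Ioi 0) := fun y hy => congrArg _ (hfg hy)
  exact ⟨h.1.congr_fun hsmul measurableSet_Ioi,
    (setIntegral_congr_fun measurableSet_Ioi hsmul).symm.trans h.2⟩

lemma hasMellin_stableDensity {x : ℝ} (hα0 : 0 < α) (hα1 : α < 1) (hx : 0 < x) (hs : 0 < s.re) :
    HasMellin (fun y => (stableDensity α x y : ℂ)) s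
      (Complex.Gamma s * ((x : ℂ) ^ (α * s - 1) / Complex.Gamma (α * s))) := by
  have hx0 : (x : ℂ) ≠ 0 := Complex.ofReal_ne_zero.2 hx.ne'
  have hre : 0 < (α * s).re := by rw [Complex.re_ofReal_mul]; positivity
  have hre₂ : 0 < (α * s + 2).re := by rw [Complex.add_re, Complex.re_ofNat]; linarith
  have hmellin := hasMellin_bromwich (F := stableExpDeriv₂ α)
    (integrable_cpow_mul_stableExpDeriv₂_vertical hα0 hα1 hs one_pos) x
  rw [bromwich_congr fun u hu => (hasMellin_stableExpDeriv₂ (abs_lt.2 ⟨by linarith, hα1⟩) hs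
      (hu ▸ one_pos)).2, bromwich_const_mul, bromwich_cpow_neg
      (by rw [Complex.add_re, Complex.re_ofNat]; linarith) one_pos hx] at hmellin
  convert hasMellin_congr (hasMellin_const_smul hmellin.1 ((x : ℂ) ^ 2)⁻¹) fun y hy => ?_ using 1
  · have hGamma := Complex.Gamma_ne_zero_of_re_pos hre₂
    rw [Gamma_add_two hre, mul_ne_zero_iff, mul_ne_zero_iff, mul_ne_zero_iff] at hGamma
    obtain ⟨⟨hαs1, hαne, hsne⟩, hΓ⟩ := hGamma
    have hpow : (x : ℂ) ^ (α * s + 2 - 1) = (x : ℂ) ^ (α * s - 1) * (x : ℂ) ^ 2 := by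
      rw [← Complex.cpow_ofNat x 2, ← Complex.cpow_add _ _ hx0]
      ring_nf
    rw [hmellin.2, Gamma_add_two hre, hpow, smul_eq_mul]
    field_simp
  · simp only [← sq_mul_stableDensity hα0 hα1 hy one_pos]
    rw [smul_eq_mul, inv_mul_cancel_left₀ (pow_ne_zero 2 hx0)]

end StableMellin

section GammaMixture

variable {μ b C : ℝ} {f : ℝ → ℂ} {s : ℂ}

lemma mellin_neg_mul_pow_div_factorial_mul (f : ℝ → ℂ) (s z : ℂ) (k : ℕ) :
    mellin (fun y => (-(z * y)) ^ k / k.factorial * f y) s =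
      (-z) ^ k / k.factorial * mellin f (s + k) := by
  have hpow := mellin_cpow_smul f s k
  simp only [mellin, smul_eq_mul, Complex.cpow_natCast] at hpow ⊢
  rw [← hpow, ← integral_const_mul]
  congr with y
  rw [← neg_mul, mul_pow]
  ring

lemma aestronglyMeasurable_of_cexp_mul {ν : Measure ℝ} {w : ℂ}
    (hf : AEStronglyMeasurable (fun y : ℝ => Complex.exp (w * y) * f y) ν) :
    AEStronglyMeasurable f ν := by
  refine ((by fun_prop : Measurable fun y : ℝ => Complex.exp (-(w * y)))
    |>.aestronglyMeasurable.mul hf).congr (ae_of_all _ fun y => ?_)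
  simp only [Pi.mul_apply]
  rw [← mul_assoc, ← Complex.exp_add, neg_add_cancel, Complex.exp_zero, one_mul]

lemma hasSum_mellin_cexp_neg_mul {z : ℂ}
    (hf : MellinConvergent (fun y => Complex.exp (‖z‖ * y) * f y) s) :
    HasSum (fun k : ℕ => (-z) ^ k / k.factorial * mellin f (s + k))
      (mellin (fun y => Complex.exp (-(z * y)) * f y) s) := by
  have hexp (w : ℂ) : HasSum (fun k : ℕ => w ^ k / k.factorial) (Complex.exp w) := by
    rw [Complex.exp_eq_exp_ℂ]
    exact NormedSpace.expSeries_div_hasSum_exp w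
  have hexpReal (r : ℝ) : HasSum (fun k : ℕ => r ^ k / k.factorial) (Real.exp r) := by
    rw [Real.exp_eq_exp_ℝ]
    exact NormedSpace.expSeries_div_hasSum_exp r
  have hmeas : AEStronglyMeasurable (fun y : ℝ => (y : ℂ) ^ (s - 1) * f y)
      (volume.restrict (Ioi 0)) :=
    aestronglyMeasurable_of_cexp_mul (w := ‖z‖) (hf.aestronglyMeasurable.congr
      (ae_of_all _ fun y => mul_left_comm _ _ _))
  simp only [← mellin_neg_mul_pow_div_factorial_mul]
  refine hasSum_integral_of_dominated_convergence
    (fun k y => (‖z‖ * y) ^ k / k.factorial * ‖(y : ℂ) ^ (s - 1) * f y‖) (fun k => ?_)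
    (fun k => ?_) (ae_of_all _ fun y => (hexpReal _).summable.mul_right _) ?_
    (ae_of_all _ fun y => ((hexp (-(z * y))).mul_right (f y)).mul_left _)
  · exact ((by fun_prop : Measurable fun y : ℝ => (-(z * y)) ^ k / (k.factorial : ℂ))
      |>.aestronglyMeasurable.mul hmeas).congr (ae_of_all _ fun y => mul_left_comm _ _ _)
  · filter_upwards [ae_restrict_mem measurableSet_Ioi] with y (hy : 0 < y)
    rw [smul_eq_mul, mul_left_comm, norm_mul, norm_div, norm_pow, norm_neg, norm_mul,
      Complex.norm_natCast, Complex.norm_of_nonneg hy.le]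
  · refine hf.norm.congr (ae_of_all _ fun y => ?_)
    simp only
    rw [((hexpReal (‖z‖ * y)).mul_right _).tsum_eq, smul_eq_mul, mul_left_comm, norm_mul,
      ← Complex.ofReal_mul, ← Complex.ofReal_exp, Complex.norm_of_nonneg (Real.exp_nonneg _)]

lemma norm_cexp_neg_mul_mul_le (hbound : ∀ y, 0 < y → ‖f y‖ ≤ C * y ^ b) {y : ℝ} (hy : 0 < y) :
    ‖Complex.exp (-(μ * y)) * f y‖ ≤ C * (y ^ b * Real.exp (-(μ * y))) := by
  rw [norm_mul, ← Complex.ofReal_mul, ← Complex.ofReal_neg, ← Complex.ofReal_exp,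
    Complex.norm_of_nonneg (Real.exp_nonneg _), mul_comm, ← mul_assoc]
  gcongr
  exact hbound y hy

lemma isBigO_cexp_neg_mul_mul (hμ : 0 < μ) (hbound : ∀ y, 0 < y → ‖f y‖ ≤ C * y ^ b) (a : ℝ) :
    (fun y : ℝ => Complex.exp (-(μ * y)) * f y) =O[atTop] fun y => y ^ a := by
  have hdecay : (fun y : ℝ => Complex.exp (-(μ * y)) * f y) =O[atTop]
      fun y => y ^ b * Real.exp (-μ * y) := by
    refine Asymptotics.IsBigO.of_bound C ?_
    filter_upwards [eventually_gt_atTop 0] with y hy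
    rw [Real.norm_of_nonneg (by positivity), neg_mul]
    exact norm_cexp_neg_mul_mul_le hbound hy
  refine (hdecay.trans ((Asymptotics.isBigO_refl (fun y : ℝ => y ^ b) atTop).mul
    (isLittleO_exp_neg_mul_rpow_atTop hμ (a - b)).isBigO)).trans_eventuallyEq ?_
  filter_upwards [eventually_gt_atTop 0] with y hy
  rw [← Real.rpow_add hy, add_sub_cancel]

lemma mellin_cexp_neg_mul_mul_hasDerivAt (hf : Measurable f) (hμ : 0 < μ) (hb : -1 < b)
    (hbound : ∀ y, 0 < y → ‖f y‖ ≤ C * y ^ b) (hs : -b < s.re) :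
    MellinConvergent (fun y => Real.log y • (Complex.exp (-(μ * y)) * f y)) s ∧
      HasDerivAt (mellin fun y => Complex.exp (-(μ * y)) * f y)
        (mellin (fun y => Real.log y • (Complex.exp (-(μ * y)) * f y)) s) s := by
  have hint : IntegrableOn (fun y : ℝ => Complex.exp (-(μ * y)) * f y) (Ioi 0) :=
    ((integrableOn_rpow_mul_exp_neg_mul hb hμ).const_mul C).mono'
      (Measurable.aestronglyMeasurable (by fun_prop))
      ((ae_restrict_mem measurableSet_Ioi).mono fun y hy => norm_cexp_neg_mul_mul_le hbound hy)
  have hzero : (fun y : ℝ => Complex.exp (-(μ * y)) * f y) =O[𝓝[>] 0] fun y => y ^ (- -b) := by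
    refine Asymptotics.IsBigO.of_bound C ?_
    filter_upwards [self_mem_nhdsWithin] with y (hy : 0 < y)
    have hnonneg : 0 ≤ C * y ^ b := (norm_nonneg _).trans (hbound y hy)
    rw [neg_neg, Real.norm_of_nonneg (by positivity)]
    refine (norm_cexp_neg_mul_mul_le hbound hy).trans ?_
    rw [← mul_assoc]
    exact mul_le_of_le_one_right hnonneg (Real.exp_le_one_iff.2 (by nlinarith))
  exact mellin_hasDerivAt_of_isBigO_rpow hint.locallyIntegrableOn
    (isBigO_cexp_neg_mul_mul hμ hbound _) (lt_add_one s.re) hzero hs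

/-- The mixture of `f` against the gamma density with rate `μ` and shape `s`, written as a Mellin
transform so that the shape can be complex. -/
noncomputable def gammaMixture (μ : ℝ) (f : ℝ → ℂ) (s : ℂ) : ℂ :=
  (μ : ℂ) ^ s * (Complex.Gamma s)⁻¹ * mellin (fun y => Complex.exp (-(μ * y)) * f y) s

lemma gammaMixture_zero (μ : ℝ) (f : ℝ → ℂ) : gammaMixture μ f 0 = 0 := by
  simp [gammaMixture, Complex.Gamma_zero]

lemma ofReal_gammaPDFReal {y : ℝ} (hμ : 0 ≤ μ) (hy : 0 ≤ y) (s : ℝ) :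
    (gammaPDFReal s μ y : ℂ) = (μ : ℂ) ^ (s : ℂ) * (Complex.Gamma s)⁻¹ *
      ((y : ℂ) ^ (s - 1 : ℂ) * Complex.exp (-(μ * y))) := by
  rw [gammaPDFReal, if_pos hy]
  push_cast [Complex.ofReal_cpow hμ, Complex.ofReal_cpow hy, Complex.Gamma_ofReal]
  ring

lemma gammaMixture_ofReal (hμ : 0 ≤ μ) (f : ℝ → ℂ) (s : ℝ) :
    gammaMixture μ f s = ∫ y in Ioi (0 : ℝ), gammaPDFReal s μ y * f y := by
  rw [gammaMixture, mellin, ← integral_const_mul]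
  refine setIntegral_congr_fun measurableSet_Ioi fun y (hy : 0 < y) => ?_
  simp only [ofReal_gammaPDFReal hμ hy.le, smul_eq_mul]
  ring

lemma integrableOn_gammaPDFReal_mul_log (hf : Measurable f) (hμ : 0 < μ) (hb : -1 < b)
    (hbound : ∀ y, 0 < y → ‖f y‖ ≤ C * y ^ b) {s : ℝ} (hs : -b < s) :
    IntegrableOn (fun y => gammaPDFReal s μ y * (Real.log y * f y)) (Ioi 0) := by
  have h := (mellin_cexp_neg_mul_mul_hasDerivAt (s := s) hf hμ hb hbound hs).1
  refine IntegrableOn.congr_fun (h.const_mul ((μ : ℂ) ^ (s : ℂ) * (Complex.Gamma s)⁻¹))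
    (fun y (hy : 0 < y) => ?_) measurableSet_Ioi
  simp only [ofReal_gammaPDFReal hμ.le hy.le, smul_eq_mul, Complex.real_smul]
  ring

lemma differentiableAt_gammaMixture (hf : Measurable f) (hμ : 0 < μ) (hb : -1 < b)
    (hbound : ∀ y, 0 < y → ‖f y‖ ≤ C * y ^ b) (hs : -b < s.re) :
    DifferentiableAt ℂ (gammaMixture μ f) s :=
  ((differentiableAt_id.const_cpow (Or.inl (Complex.ofReal_ne_zero.2 hμ.ne'))).mul
    (Complex.differentiable_one_div_Gamma s)).mul
      (mellin_cexp_neg_mul_mul_hasDerivAt hf hμ hb hbound hs).2.differentiableAt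

lemma continuousAt_deriv_gammaMixture (hf : Measurable f) (hμ : 0 < μ) (hb : -1 < b)
    (hbound : ∀ y, 0 < y → ‖f y‖ ≤ C * y ^ b) (hs : -b < s.re) :
    ContinuousAt (deriv (gammaMixture μ f)) s := by
  have hana : AnalyticOnNhd ℂ (gammaMixture μ f) {w : ℂ | -b < w.re} :=
    DifferentiableOn.analyticOnNhd (fun w hw =>
      (differentiableAt_gammaMixture hf hμ hb hbound hw).differentiableWithinAt)
      (isOpen_lt continuous_const Complex.continuous_re)
  exact (hana.deriv s hs).continuousAt

lemma deriv_gammaMixture (hf : Measurable f) (hμ : 0 < μ) (hb : -1 < b)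
    (hbound : ∀ y, 0 < y → ‖f y‖ ≤ C * y ^ b) (hs : -b < s.re) (hGamma : Complex.Gamma s ≠ 0) :
    deriv (gammaMixture μ f) s = (Complex.log μ - Complex.digamma s) * gammaMixture μ f s +
      gammaMixture μ (fun y => Real.log y * f y) s := by
  have hcpow : HasDerivAt (fun s : ℂ => (μ : ℂ) ^ s) _ s :=
    (hasDerivAt_id s).const_cpow (Or.inl (Complex.ofReal_ne_zero.2 hμ.ne'))
  have hinv := (Complex.differentiableAt_Gamma s fun m hm =>
    hGamma (hm ▸ Complex.Gamma_neg_nat_eq_zero m)).hasDerivAt.inv hGamma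
  have hmix := (hcpow.mul hinv).mul
    (mellin_cexp_neg_mul_mul_hasDerivAt hf hμ hb hbound hs).2
  simp only [Complex.real_smul, mul_left_comm _ (Complex.exp _)] at hmix
  refine hmix.deriv.trans ?_
  simp only [gammaMixture, Complex.digamma_def, logDeriv_apply, id, Pi.mul_apply, Pi.inv_apply]
  field_simp
  ring

end GammaMixture

section MittagLefflerDensity

variable {α ρ μ x t : ℝ}

lemma hasSum_mellin_cexp_neg_mul_stableDensity {s : ℂ} (hα0 : 0 < α) (hα1 : α < 1) (hx : 0 < x)
    (hs : 0 < s.re) (z : ℂ) :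
    HasSum (fun k : ℕ => (-z) ^ k / k.factorial * (Complex.Gamma (s + k) *
        ((x : ℂ) ^ (α * (s + k) - 1) / Complex.Gamma (α * (s + k)))))
      (mellin (fun y => Complex.exp (-(z * y)) * stableDensity α x y) s) := by
  obtain ⟨C, hC⟩ := exists_abs_stableDensity_le hα0 hα1 hx.ne' (‖z‖ + 1)
  have hconv : MellinConvergent (fun y => Complex.exp (‖z‖ * y) * stableDensity α x y) s := by
    have hmeas := measurable_stableDensity α x
    refine ((integrableOn_rpow_mul_exp_neg_mul (s := s.re) (by linarith) one_pos).const_mul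
      C).mono' (Measurable.aestronglyMeasurable (by fun_prop)) ?_
    filter_upwards [ae_restrict_mem measurableSet_Ioi] with y (hy : 0 < y)
    rw [norm_smul, norm_mul, Complex.norm_cpow_eq_rpow_re_of_pos hy, Complex.norm_real,
      Real.norm_eq_abs, ← Complex.ofReal_mul, ← Complex.ofReal_exp,
      Complex.norm_of_nonneg (Real.exp_nonneg _), Complex.sub_re, Complex.one_re]
    calc y ^ (s.re - 1) * (Real.exp (‖z‖ * y) * |stableDensity α x y|)
        ≤ y ^ (s.re - 1) * (Real.exp (‖z‖ * y) * (C * (y * Real.exp (-((‖z‖ + 1) * y))))) := by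
          gcongr
          exact hC y hy
      _ = C * (y ^ (s.re - 1) * y * (Real.exp (‖z‖ * y) * Real.exp (-((‖z‖ + 1) * y)))) := by
          ring
      _ = C * (y ^ s.re * Real.exp (-(1 * y))) := by
          rw [← Real.exp_add, ← Real.rpow_add_one hy.ne', sub_add_cancel]
          ring_nf
  refine (hasSum_mellin_cexp_neg_mul hconv).congr_fun fun k => ?_
  rw [(hasMellin_stableDensity hα0 hα1 hx (s := s + k) ?_).2]
  rw [Complex.add_re, Complex.natCast_re]
  positivity

lemma ofReal_mlDensity_eq_gammaMixture (hα0 : 0 < α) (hα1 : α < 1) (hμ : 0 < μ) (hx : 0 < x)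
    (hρt : 0 < ρ * t) :
    (mlDensity α ρ μ x t : ℂ) =
      gammaMixture μ (fun y => stableDensity α x y) ((ρ * t : ℝ) : ℂ) := by
  have hsum := hasSum_mellin_cexp_neg_mul_stableDensity (s := (ρ * t : ℝ)) hα0 hα1 hx hρt μ
  have hμ0 : (μ : ℂ) ≠ 0 := Complex.ofReal_ne_zero.2 hμ.ne'
  rw [gammaMixture, ← (hsum.mul_left _).tsum_eq, mlDensity, Complex.ofReal_tsum]
  congr with k
  have hpow : (μ : ℂ) ^ ((ρ * t + k : ℝ) : ℂ) = (μ : ℂ) ^ ((ρ * t : ℝ) : ℂ) * (μ : ℂ) ^ k := by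
    rw [Complex.ofReal_add, Complex.ofReal_natCast, Complex.cpow_add _ _ hμ0, Complex.cpow_natCast]
  rw [Real.Gamma_nat_eq_factorial]
  push_cast [Complex.ofReal_cpow hμ.le, Complex.ofReal_cpow hx.le, ← Complex.Gamma_ofReal] at hpow ⊢
  rw [hpow, neg_pow (μ : ℂ)]
  ring

lemma mlBracket_eq_re_deriv_gammaMixture (hα0 : 0 < α) (hα1 : α < 1) (hμ : 0 < μ) (hx : 0 < x)
    (hρt : 0 < ρ * t) :
    mlBracket α ρ μ x t =
      (deriv (gammaMixture μ fun y => stableDensity α x y) ((ρ * t : ℝ) : ℂ)).re := by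
  obtain ⟨C, hC⟩ := exists_norm_stableDensity_le_rpow hα0 hα1 hx.ne'
  have hlog : gammaMixture μ (fun y => Real.log y * stableDensity α x y) ((ρ * t : ℝ) : ℂ) =
      ((∫ y in Ioi (0 : ℝ), stableDensity α x y * Real.log y * gammaDensity ρ μ y t : ℝ) : ℂ) := by
    rw [gammaMixture_ofReal hμ.le, ← integral_complex_ofReal]
    congr with y
    rw [gammaDensity]
    push_cast
    ring
  rw [deriv_gammaMixture (measurable_stableDensity α x).complex_ofReal hμ (by norm_num) hC
      (by rw [Complex.ofReal_re]; linarith)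
      (Complex.Gamma_ne_zero_of_re_pos (by rwa [Complex.ofReal_re])),
    ← ofReal_mlDensity_eq_gammaMixture hα0 hα1 hμ hx hρt, hlog, Complex.add_re,
    Complex.re_mul_ofReal, Complex.sub_re, ← Complex.ofReal_log hμ.le, Complex.ofReal_re,
    Complex.ofReal_re, mlBracket, digamma]

lemma integrableOn_stableDensity_mul_log_mul_gammaDensity (hα0 : 0 < α) (hα1 : α < 1) (hμ : 0 < μ)
    (hx : x ≠ 0) (hρt : -1 < ρ * t) :
    IntegrableOn (fun y => stableDensity α x y * Real.log y * gammaDensity ρ μ y t) (Ioi 0) := by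
  obtain ⟨C, hC⟩ := exists_norm_stableDensity_le_rpow hα0 hα1 hx
  have h := integrableOn_gammaPDFReal_mul_log (measurable_stableDensity α x).complex_ofReal hμ
    (by norm_num) hC hρt
  refine (Integrable.re h).congr (ae_of_all _ fun y => ?_)
  simp only [← Complex.ofReal_mul, RCLike.re_eq_complex_re, Complex.ofReal_re, gammaDensity]
  ring

end MittagLefflerDensity

section RiemannLiouville

variable {ν t : ℝ} {f g p p' : ℝ → ℝ}

lemma rlIntegral_of_ne_zero (hν : ν ≠ 0) (f : ℝ → ℝ) (t : ℝ) :
    rlIntegral ν f t = (Real.Gamma ν)⁻¹ * ∫ u in (0 : ℝ)..t, (t - u) ^ (ν - 1) * f u :=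
  if_neg hν

lemma rlIntegral_zero (f : ℝ → ℝ) : rlIntegral 0 f = f :=
  funext fun _ => if_pos rfl

lemma rlIntegral_congr (ht : 0 < t) (h : EqOn f g (Ioc 0 t)) :
    rlIntegral ν f t = rlIntegral ν g t := by
  rcases eq_or_ne ν 0 with rfl | hν
  · rw [rlIntegral_zero, rlIntegral_zero, h ⟨ht, le_rfl⟩]
  · rw [rlIntegral_of_ne_zero hν, rlIntegral_of_ne_zero hν,
      intervalIntegral.integral_congr_Ioo_of_le ht.le fun u hu => ?_]
    simp only [h (Ioo_subset_Ioc_self hu)]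

lemma rlIntegral_const_mul (ν r : ℝ) (f : ℝ → ℝ) (t : ℝ) :
    rlIntegral ν (fun u => r * f u) t = r * rlIntegral ν f t := by
  rcases eq_or_ne ν 0 with rfl | hν
  · rw [rlIntegral_zero, rlIntegral_zero]
  · simp only [rlIntegral_of_ne_zero hν, mul_left_comm _ r, intervalIntegral.integral_const_mul]

lemma intervalIntegrable_sub_rpow (hν : 0 < ν) (t : ℝ) :
    IntervalIntegrable (fun u => (t - u) ^ (ν - 1)) volume 0 t := by
  have h := (intervalIntegral.intervalIntegrable_rpow' (a := 0) (b := t)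
    (by linarith : -1 < ν - 1)).comp_sub_left t
  rw [sub_zero, sub_self] at h
  exact h.symm

lemma rlIntegrable_of_eqOn_of_continuousOn (hν : 0 ≤ ν) (ht : 0 < t)
    (hg : ContinuousOn g (Icc 0 t)) (h : EqOn f g (Ioc 0 t)) : RLIntegrable ν f t := by
  rcases hν.eq_or_lt with rfl | hν
  · exact Or.inl rfl
  · rw [← uIcc_of_le ht.le] at hg
    rw [← uIoc_of_le ht.le] at h
    refine Or.inr (((intervalIntegrable_sub_rpow hν t).mul_continuousOn hg).congr fun u hu => ?_)
    simp only [h hu]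

lemma integral_sub_rpow_mul_eq_rpow_mul (ht : 0 < t) (f : ℝ → ℝ) :
    ∫ u in (0 : ℝ)..t, (t - u) ^ (ν - 1) * f u =
      t ^ ν * ∫ r in (0 : ℝ)..1, (1 - r) ^ (ν - 1) * f (t * r) := by
  have hpow : t ^ ν = t * t ^ (ν - 1) := by
    rw [mul_comm, ← Real.rpow_add_one ht.ne', sub_add_cancel]
  have hscale := intervalIntegral.mul_integral_comp_mul_left (a := 0) (b := 1)
    (f := fun u => (t - u) ^ (ν - 1) * f u) t
  rw [mul_zero, mul_one] at hscale
  rw [← hscale, hpow, mul_assoc, ← intervalIntegral.integral_const_mul (t ^ (ν - 1))]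
  congr 1
  refine intervalIntegral.integral_congr_Ioo_of_le zero_le_one fun r hr => ?_
  simp only [← mul_assoc, ← Real.mul_rpow ht.le (sub_pos.2 hr.2).le, mul_sub, mul_one]

lemma continuousOn_comp_mul_left (ht : 0 ≤ t) (hf : ContinuousOn f (Ici 0)) :
    ContinuousOn (fun r => f (t * r)) (uIcc 0 1) :=
  hf.comp (by fun_prop) fun r hr => by
    rw [uIcc_of_le zero_le_one] at hr
    exact mul_nonneg ht hr.1

lemma hasDerivAt_integral_mul_comp_mul {k : ℝ → ℝ} (hk : IntervalIntegrable k volume 0 1)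
    (ht : 0 < t) (hpc : ContinuousOn p (Ici 0)) (hp : ∀ s, 0 < s → HasDerivAt p (p' s) s)
    (hp' : ContinuousOn p' (Ici 0)) :
    HasDerivAt (fun t => ∫ r in (0 : ℝ)..1, k r * p (t * r))
      (∫ r in (0 : ℝ)..1, k r * (r * p' (t * r))) t := by
  obtain ⟨M, hM⟩ := (isCompact_Icc (a := 0) (b := t + 1)).exists_bound_of_continuousOn
    (hp'.mono Icc_subset_Ici_self)
  have hint {q : ℝ → ℝ} (hq : ContinuousOn q (uIcc 0 1)) :
      IntervalIntegrable (fun r => k r * q r) volume 0 1 := hk.mul_continuousOn hq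
  refine (intervalIntegral.hasDerivAt_integral_of_dominated_loc_of_deriv_le
    (F := fun t r => k r * p (t * r)) (F' := fun t r => k r * (r * p' (t * r)))
    (bound := fun r => ‖k r‖ * M) (Ioo_mem_nhds ht (lt_add_one t)) ?_
    (hint (continuousOn_comp_mul_left ht.le hpc))
    (hint (continuousOn_id.mul
      (continuousOn_comp_mul_left ht.le hp'))).aestronglyMeasurable_restrict_uIoc
    (ae_of_all _ fun r hr s hs => ?_) (hk.norm.mul_const M)
    (ae_of_all _ fun r hr s hs => ?_)).2
  · filter_upwards [lt_mem_nhds ht] with s hs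
    exact (hint (continuousOn_comp_mul_left hs.le hpc)).aestronglyMeasurable_restrict_uIoc
  · rw [uIoc_of_le zero_le_one] at hr
    have hsr : s * r ∈ Icc 0 (t + 1) :=
      ⟨mul_nonneg hs.1.le hr.1.le, (mul_le_of_le_one_right hs.1.le hr.2).trans hs.2.le⟩
    rw [norm_mul, norm_mul, Real.norm_of_nonneg hr.1.le]
    gcongr
    exact (mul_le_of_le_one_left (norm_nonneg _) hr.2).trans (hM _ hsr)
  · rw [uIoc_of_le zero_le_one] at hr
    have hscaled := (hp (s * r) (mul_pos hs.1 hr.1)).comp s (hasDerivAt_mul_const (x := s) r)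
    exact (hscaled.congr_deriv (mul_comm _ _)).const_mul (k r)

lemma mul_integral_one_sub_rpow_mul_comp_mul (hν : 0 < ν) (ht : 0 < t)
    (hpc : ContinuousOn p (Ici 0)) (hp : ∀ s, 0 < s → HasDerivAt p (p' s) s)
    (hp' : ContinuousOn p' (Ici 0)) (hp0 : p 0 = 0) :
    ν * ∫ r in (0 : ℝ)..1, (1 - r) ^ (ν - 1) * p (t * r) =
      t * ∫ r in (0 : ℝ)..1, (1 - r) ^ ν * p' (t * r) := by
  have hparts := intervalIntegral.integral_mul_deriv_eq_deriv_mul_of_hasDerivAt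
    (a := 0) (b := 1) (u := fun r => (1 - r) ^ ν) (u' := fun r => -(ν * (1 - r) ^ (ν - 1)))
    (v := fun r => p (t * r)) (v' := fun r => t * p' (t * r))
    ((continuousOn_const.sub continuousOn_id).rpow_const fun _ _ => Or.inr hν.le)
    (continuousOn_comp_mul_left ht.le hpc) (fun r hr => ?_) (fun r hr => ?_)
    ((intervalIntegrable_sub_rpow hν 1).const_mul ν).neg
    (((continuousOn_comp_mul_left ht.le hp').const_smul t).intervalIntegrable)
  · rw [sub_self, Real.zero_rpow hν.ne', mul_zero, hp0] at hparts
    simp only [mul_left_comm _ t, neg_mul, mul_assoc, intervalIntegral.integral_neg,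
      intervalIntegral.integral_const_mul] at hparts
    linarith
  · rw [min_eq_left zero_le_one, max_eq_right zero_le_one] at hr
    refine (((hasDerivAt_id r).const_sub 1).rpow_const
      (Or.inl (sub_pos.2 hr.2).ne')).congr_deriv ?_
    simp only [id]
    ring
  · rw [min_eq_left zero_le_one, max_eq_right zero_le_one] at hr
    have hscaled := (hp (t * r) (mul_pos ht hr.1)).comp r (hasDerivAt_const_mul t)
    exact hscaled.congr_deriv (mul_comm _ _)

lemma integral_one_sub_rpow_mul_eq_add (hν : 0 < ν) (hf : ContinuousOn f (uIcc 0 1)) :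
    ∫ r in (0 : ℝ)..1, (1 - r) ^ (ν - 1) * f r =
      (∫ r in (0 : ℝ)..1, (1 - r) ^ ν * f r) +
        ∫ r in (0 : ℝ)..1, (1 - r) ^ (ν - 1) * (r * f r) := by
  have hleft : IntervalIntegrable (fun r => (1 - r) ^ ν * f r) volume 0 1 :=
    (((continuousOn_const.sub continuousOn_id).rpow_const
      fun _ _ => Or.inr hν.le).mul hf).intervalIntegrable
  have hright : IntervalIntegrable (fun r => (1 - r) ^ (ν - 1) * (r * f r)) volume 0 1 :=
    (intervalIntegrable_sub_rpow hν 1).mul_continuousOn (continuousOn_id.mul hf)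
  rw [← intervalIntegral.integral_add hleft hright]
  refine intervalIntegral.integral_congr_Ioo_of_le zero_le_one fun r hr => ?_
  have hpow : (1 - r) ^ ν = (1 - r) ^ (ν - 1) * (1 - r) := by
    rw [← Real.rpow_add_one (sub_pos.2 hr.2).ne', sub_add_cancel]
  simp only [hpow]
  ring

lemma hasDerivAt_rlIntegral (hν : 0 ≤ ν) (ht : 0 < t) (hpc : ContinuousOn p (Ici 0))
    (hp : ∀ s, 0 < s → HasDerivAt p (p' s) s) (hp' : ContinuousOn p' (Ici 0)) (hp0 : p 0 = 0) :
    HasDerivAt (rlIntegral ν p) (rlIntegral ν p' t) t := by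
  rcases hν.eq_or_lt with rfl | hν
  · rw [rlIntegral_zero, rlIntegral_zero]
    exact hp t ht
  -- Scaling moves `t` from the singular kernel and the endpoint into the smooth factor `p`.
  have hscaled : rlIntegral ν p =ᶠ[𝓝 t] fun t =>
      (Real.Gamma ν)⁻¹ * (t ^ ν * ∫ r in (0 : ℝ)..1, (1 - r) ^ (ν - 1) * p (t * r)) := by
    filter_upwards [lt_mem_nhds ht] with s hs
    rw [rlIntegral_of_ne_zero hν.ne', integral_sub_rpow_mul_eq_rpow_mul hs]
  have hk := intervalIntegrable_sub_rpow hν 1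
  have hderiv := ((Real.hasDerivAt_rpow_const (p := ν) (Or.inl ht.ne')).mul
    (hasDerivAt_integral_mul_comp_mul hk ht hpc hp hp')).const_mul (Real.Gamma ν)⁻¹
  refine (hderiv.congr_of_eventuallyEq hscaled).congr_deriv ?_
  rw [rlIntegral_of_ne_zero hν.ne', integral_sub_rpow_mul_eq_rpow_mul ht,
    integral_one_sub_rpow_mul_eq_add hν (continuousOn_comp_mul_left ht.le hp')]
  have hparts := mul_integral_one_sub_rpow_mul_comp_mul hν ht hpc hp hp' hp0
  have hpow : t ^ ν = t ^ (ν - 1) * t := by rw [← Real.rpow_add_one ht.ne', sub_add_cancel]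
  linear_combination (Real.Gamma ν)⁻¹ * t ^ (ν - 1) * hparts - (Real.Gamma ν)⁻¹ *
    (∫ r in (0 : ℝ)..1, (1 - r) ^ ν * p' (t * r)) * hpow

lemma rlDeriv_of_mem_Ioc {σ : ℝ} (hσ : σ ∈ Ioc 0 1) (f : ℝ → ℝ) (t : ℝ) :
    rlDeriv σ f t = deriv (rlIntegral (1 - σ) f) t := by
  have hceil : ⌈σ⌉₊ = 1 := by
    rw [Nat.ceil_eq_iff one_ne_zero, Nat.sub_self, Nat.cast_zero, Nat.cast_one]
    exact hσ
  rw [rlDeriv, hceil, iteratedDeriv_one, Nat.cast_one]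

lemma rlDeriv_of_nonpos {σ : ℝ} (hσ : σ ≤ 0) (f : ℝ → ℝ) (t : ℝ) :
    rlDeriv σ f t = rlIntegral (-σ) f t := by
  rw [rlDeriv, Nat.ceil_eq_zero.2 hσ, iteratedDeriv_zero, Nat.cast_zero, zero_sub]

end RiemannLiouville

section MittagLeffler

variable {α ρ μ x ν t : ℝ}

/-- The density of the Mittag-Leffler Lévy process as a function of time, extended smoothly across
`t = 0`; the series `mlDensity` is only meaningful for `t > 0`. -/
noncomputable def mlMixture (α ρ μ x t : ℝ) : ℝ :=
  (gammaMixture μ (fun y => stableDensity α x y) (ρ * t : ℝ)).re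

lemma mlMixture_zero (α ρ μ x : ℝ) : mlMixture α ρ μ x 0 = 0 := by
  rw [mlMixture, mul_zero, Complex.ofReal_zero, gammaMixture_zero, Complex.zero_re]

lemma mlDensity_eq_mlMixture (hα0 : 0 < α) (hα1 : α < 1) (hμ : 0 < μ) (hx : 0 < x)
    (hρt : 0 < ρ * t) : mlDensity α ρ μ x t = mlMixture α ρ μ x t := by
  rw [mlMixture, ← ofReal_mlDensity_eq_gammaMixture hα0 hα1 hμ hx hρt, Complex.ofReal_re]

lemma hasDerivAt_mlMixture (hα0 : 0 < α) (hα1 : α < 1) (hμ : 0 < μ) (hx : x ≠ 0)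
    (hρt : -1 < ρ * t) :
    HasDerivAt (mlMixture α ρ μ x)
      (ρ * (deriv (gammaMixture μ fun y => stableDensity α x y) (ρ * t : ℝ)).re) t := by
  obtain ⟨C, hC⟩ := exists_norm_stableDensity_le_rpow hα0 hα1 hx
  have hshape := (differentiableAt_gammaMixture (s := (ρ * t : ℝ))
    (measurable_stableDensity α x).complex_ofReal hμ (by norm_num) hC hρt)
  exact (hshape.hasDerivAt.real_of_complex.comp t (hasDerivAt_const_mul ρ)).congr_deriv
    (mul_comm _ _)

lemma deriv_mlMixture (hα0 : 0 < α) (hα1 : α < 1) (hμ : 0 < μ) (hx : 0 < x) (hρt : 0 < ρ * t) :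
    deriv (mlMixture α ρ μ x) t = ρ * mlBracket α ρ μ x t := by
  rw [(hasDerivAt_mlMixture hα0 hα1 hμ hx.ne' (by linarith)).deriv,
    mlBracket_eq_re_deriv_gammaMixture hα0 hα1 hμ hx hρt]

lemma continuousOn_deriv_mlMixture (hα0 : 0 < α) (hα1 : α < 1) (hμ : 0 < μ) (hx : x ≠ 0) :
    ContinuousOn (deriv (mlMixture α ρ μ x)) {t | -1 < ρ * t} := by
  obtain ⟨C, hC⟩ := exists_norm_stableDensity_le_rpow hα0 hα1 hx
  refine ContinuousOn.congr (fun t ht => ?_)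
    fun t ht => (hasDerivAt_mlMixture hα0 hα1 hμ hx ht).deriv
  have hshape := continuousAt_deriv_gammaMixture (s := (ρ * t : ℝ))
    (measurable_stableDensity α x).complex_ofReal hμ (by norm_num) hC ht
  exact (continuousAt_const.mul (Complex.continuous_re.continuousAt.comp
    (hshape.comp (f := fun t : ℝ => ((ρ * t : ℝ) : ℂ)) (by fun_prop)))).continuousWithinAt

lemma Ici_zero_subset_neg_one_lt_mul (hρ : 0 ≤ ρ) : Ici 0 ⊆ {t | -1 < ρ * t} := fun _ ht =>
  neg_one_lt_zero.trans_le (mul_nonneg hρ ht)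

lemma continuousOn_mlMixture (hα0 : 0 < α) (hα1 : α < 1) (hμ : 0 < μ) (hx : x ≠ 0) :
    ContinuousOn (mlMixture α ρ μ x) {t | -1 < ρ * t} := fun _ ht =>
  (hasDerivAt_mlMixture hα0 hα1 hμ hx ht).continuousAt.continuousWithinAt

lemma rlIntegrable_mlDensity (hα0 : 0 < α) (hα1 : α < 1) (hρ : 0 < ρ) (hμ : 0 < μ) (hx : 0 < x)
    (hν : 0 ≤ ν) (ht : 0 < t) : RLIntegrable ν (mlDensity α ρ μ x) t :=
  rlIntegrable_of_eqOn_of_continuousOn hν ht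
    ((continuousOn_mlMixture hα0 hα1 hμ hx.ne').mono
      (Icc_subset_Ici_self.trans (Ici_zero_subset_neg_one_lt_mul hρ.le)))
    fun _ hs => mlDensity_eq_mlMixture hα0 hα1 hμ hx (mul_pos hρ hs.1)

lemma rlIntegrable_mlBracket (hα0 : 0 < α) (hα1 : α < 1) (hρ : 0 < ρ) (hμ : 0 < μ) (hx : 0 < x)
    (hν : 0 ≤ ν) (ht : 0 < t) : RLIntegrable ν (mlBracket α ρ μ x) t := by
  refine rlIntegrable_of_eqOn_of_continuousOn hν ht
    (((continuousOn_deriv_mlMixture hα0 hα1 hμ hx.ne').mono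
      (Icc_subset_Ici_self.trans (Ici_zero_subset_neg_one_lt_mul hρ.le))).const_smul ρ⁻¹)
    fun s hs => ?_
  rw [Pi.smul_apply, deriv_mlMixture hα0 hα1 hμ hx (mul_pos hρ hs.1), smul_eq_mul,
    inv_mul_cancel_left₀ hρ.ne']

lemma hasDerivAt_rlIntegral_mlDensity (hα0 : 0 < α) (hα1 : α < 1) (hρ : 0 < ρ) (hμ : 0 < μ)
    (hx : 0 < x) (hν : 0 ≤ ν) (ht : 0 < t) :
    HasDerivAt (rlIntegral ν (mlDensity α ρ μ x)) (ρ * rlIntegral ν (mlBracket α ρ μ x) t) t := by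
  have hsub := Ici_zero_subset_neg_one_lt_mul hρ.le
  have hmix := hasDerivAt_rlIntegral hν ht
    ((continuousOn_mlMixture hα0 hα1 hμ hx.ne').mono hsub)
    (fun s hs => (hasDerivAt_mlMixture hα0 hα1 hμ hx.ne'
      (hsub hs.le)).differentiableAt.hasDerivAt)
    ((continuousOn_deriv_mlMixture hα0 hα1 hμ hx.ne').mono hsub) (mlMixture_zero α ρ μ x)
  rw [← rlIntegral_const_mul,
    ← rlIntegral_congr ht fun s hs => deriv_mlMixture hα0 hα1 hμ hx (mul_pos hρ hs.1)]
  refine hmix.congr_of_eventuallyEq ?_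
  filter_upwards [lt_mem_nhds ht] with s hs
  exact rlIntegral_congr hs fun u hu => mlDensity_eq_mlMixture hα0 hα1 hμ hx (mul_pos hρ hu.1)

end MittagLeffler
end FracML

theorem mainTheorem4 (α ρ μ τ : ℝ) (hα0 : 0 < α) (hα1 : α < 1) (hρ : 0 < ρ) (hμ : 0 < μ)
    (hτ0 : 0 < τ) (hτ1 : τ ≤ 1) (x t : ℝ) (hx : 0 < x) (ht : 0 < t) :
    IntegrableOn
      (fun y => FracML.stableDensity α x y * Real.log y * FracML.gammaDensity ρ μ y t) (Ioi 0) ∧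
    FracML.RLIntegrable (1 - τ) (fun s => FracML.mlDensity α ρ μ x s) t ∧
    FracML.RLIntegrable (1 - τ) (fun s => FracML.mlBracket α ρ μ x s) t ∧
    DifferentiableAt ℝ (FracML.rlIntegral (1 - τ) (fun s => FracML.mlDensity α ρ μ x s)) t ∧
    FracML.rlDeriv τ (fun s => FracML.mlDensity α ρ μ x s) t =
      ρ * FracML.rlDeriv (τ - 1) (fun s => FracML.mlBracket α ρ μ x s) t := by
  have hν : 0 ≤ 1 - τ := sub_nonneg.2 hτ1
  have hderiv := FracML.hasDerivAt_rlIntegral_mlDensity hα0 hα1 hρ hμ hx hν ht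
  refine ⟨FracML.integrableOn_stableDensity_mul_log_mul_gammaDensity hα0 hα1 hμ hx.ne'
      (neg_one_lt_zero.trans (mul_pos hρ ht)),
    FracML.rlIntegrable_mlDensity hα0 hα1 hρ hμ hx hν ht,
    FracML.rlIntegrable_mlBracket hα0 hα1 hρ hμ hx hν ht, hderiv.differentiableAt, ?_⟩
  rw [FracML.rlDeriv_of_mem_Ioc ⟨hτ0, hτ1⟩, FracML.rlDeriv_of_nonpos (sub_nonpos.2 hτ1), neg_sub]
  exact hderiv.deriv
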